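/- Consider ergometric refinement session types over natural-number index variables, $$A ::= \oplus\{\ell : A_\ell\}_{\ell\in L} \mid \&\{\ell : A_\ell\}_{\ell\in L} \mid A\otimes A \mid A\multimap A \mid \mathbf 1 \mid V[\overline e] \mid ?\{\phi\}.A \mid\ !\{\phi\}.A \mid \exists n.A \mid \forall n.A \mid \triangleright^r A \mid \triangleleft^r A,$$ relative to a fixed signature $\Sigma$ of contractive, valid and polarized equirecursive type definitions and of process declarations whose types are valid, polarized and structural at the top level. Type names are unfolded silently. A type is *structural* ($S$) if its outermost constructor is $\oplus,\&,\otimes,\multimap,\mathbf 1,\exists$ or $\forall$. It is *positive* or *negative* according to $A^+ ::= S \mid ?\{\phi\}.A^+ \mid \triangleright^r A^+$ and $A^- ::= S \mid !\{\phi\}.A^- \mid \triangleleft^r A^-$. It is *polarized* if hereditarily every component is positive or negative and the left components of $\otimes$ and $\multimap$ are structural. It is *valid* under constraints $C$ if its type names are declared and each index and potential in it provably denotes a natural number under the constraints known at its occurrence. The *implicit* typing judgment $\mathcal V;C;\Delta\vdash_i^{q} P::(x:A)$ has the rules of the explicit system $\mathcal V;C;\Delta\vdash^{q} P::(x:A)$,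 except that the rules for $?,!,\triangleright,\triangleleft$ leave the program unchanged (no assert, assume, pay or get in $P$). The *forcing calculus* has sequents $\mathcal V;C;\Delta^-;\Omega\vdash^{q} P::(x:A)$ with $\Omega$ ordered. Its inversion rules apply $!R$ and $\triangleleft R$ eagerly, and then, with a positive succedent, $?L$ and $\triangleright L$ at the right end of $\Omega$; negative antecedents are moved from $\Omega$ to $\Delta^-$. When $\Omega$ is empty and the succedent is positive, a channel that takes part in the next action may be forced. The rules $?R, \triangleright R, !L, \triangleleft L$ apply only to a forced channel. A structural rule applies to a forced channel of structural type, loses the forcing, and puts the new or continued antecedents into $\Omega$. Channels that an action hands over or identifies (in send, forward and spawn) can be forced as well; they lose the forcing when their type has become structural, as these rules require. **Theorem.** Let $C$ be a constraint over $\mathcal V$, let $A$ and all types in $\Delta$ be polarized and valid under $C$, let the channels in $\Delta, x$ be distinct, let $q$ denote a natural number under $C$, and list $\Delta$ in any order. Then for every program $P$: 1. (Completeness) If $\mathcal V;C;\Delta\vdash_i^{q} P::(x:A)$, then $\mathcal V;C;\cdot\,;\Delta\vdash^{q} P::(x:A)$ in the forcing calculus. 2. (Soundness) If $\mathcal V;C;\cdot\,;\Delta\vdash^{q}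 P::(x:A)$ in the forcing calculus, then $\mathcal V;C;\Delta\vdash_i^{q} P::(x:A)$. Consequently, $\mathcal V;C;\cdot\,;\Delta\vdash^{q} P::(x:A)$ holds in the forcing calculus if and only if there is an explicit program $E$ with $\mathcal V;C;\Delta\vdash^{q} E::(x:A)$ in the explicit system such that erasing all assert, assume, pay and get constructs from $E$ gives $P$. -/

import Mathlib

namespace ErgoSession

/-- Labels of choice types; any countably infinite supply of names will do. -/
abbrev Label := ℕ
/-- Channel names. -/
abbrev Chan := ℕ

/-! ## Arithmetic: expressions, propositions, entailment

Index variables are de Bruijn indices: a context `𝒱` of `n` natural-number variables is the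
number `n`, and an object over `𝒱` lives in the `n`-th member of the corresponding family. -/

/-- Arithmetic expressions `e ::= i | e + e | e - e | i × e | n`. -/
inductive Exp (n : ℕ) : Type
  | var (i : Fin n)
  | const (i : ℕ)
  | add (a b : Exp n)
  | sub (a b : Exp n)
  | mul (i : ℕ) (a : Exp n)

namespace Exp

/-- Value of an expression. Subtraction is integer subtraction. -/
def eval {n : ℕ} (ρ : Fin n → ℤ) : Exp n → ℤ
  | var i => ρ i
  | const i => (i : ℤ)
  | add a b => a.eval ρ + b.eval ρ
  | sub a b => a.eval ρ - b.eval ρ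
  | mul i a => (i : ℤ) * a.eval ρ

/-- Simultaneous substitution. -/
def subst {n m : ℕ} (σ : Fin n → Exp m) : Exp n → Exp m
  | var i => σ i
  | const i => const i
  | add a b => add (a.subst σ) (b.subst σ)
  | sub a b => sub (a.subst σ) (b.subst σ)
  | mul i a => mul i (a.subst σ)

/-- The same expression in a context with one more variable. -/
def weaken {n : ℕ} (e : Exp n) : Exp (n + 1) := e.subst (fun i => var i.succ)

end Exp

/-- Lifting a substitution under a binder. -/
def liftSubst {n m : ℕ} (σ : Fin n → Exp m) : Fin (n + 1) → Exp (m + 1) :=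
  Fin.cases (Exp.var 0) (fun i => (σ i).weaken)

/-- The substitution `[e/n]` for the most recently bound variable. -/
def instSubst {n : ℕ} (e : Exp n) : Fin (n + 1) → Exp n :=
  Fin.cases e Exp.var

/-- Arithmetic propositions. -/
inductive Fml : ℕ → Type
  | eq {n : ℕ} (a b : Exp n) : Fml n
  | gt {n : ℕ} (a b : Exp n) : Fml n
  | tt {n : ℕ} : Fml n
  | ff {n : ℕ} : Fml n
  | and {n : ℕ} (φ ψ : Fml n) : Fml n
  | or {n : ℕ} (φ ψ : Fml n) : Fml n
  | neg {n : ℕ} (φ : Fml n) : Fml n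
  | ex {n : ℕ} (φ : Fml (n + 1)) : Fml n
  | all {n : ℕ} (φ : Fml (n + 1)) : Fml n

namespace Fml

/-- Truth of a proposition; the quantifiers range over the natural numbers. -/
def Holds : {n : ℕ} → Fml n → (Fin n → ℤ) → Prop
  | _, eq a b, ρ => a.eval ρ = b.eval ρ
  | _, gt a b, ρ => b.eval ρ < a.eval ρ
  | _, tt, _ => True
  | _, ff, _ => False
  | _, and φ ψ, ρ => φ.Holds ρ ∧ ψ.Holds ρ
  | _, or φ ψ, ρ => φ.Holds ρ ∨ ψ.Holds ρ
  | _, neg φ, ρ => ¬ φ.Holds ρ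
  | _, ex φ, ρ => ∃ i : ℕ, φ.Holds (Fin.cases (i : ℤ) ρ)
  | _, all φ, ρ => ∀ i : ℕ, φ.Holds (Fin.cases (i : ℤ) ρ)

def subst : {n m : ℕ} → (Fin n → Exp m) → Fml n → Fml m
  | _, _, σ, eq a b => eq (a.subst σ) (b.subst σ)
  | _, _, σ, gt a b => gt (a.subst σ) (b.subst σ)
  | _, _, _, tt => tt
  | _, _, _, ff => ff
  | _, _, σ, and φ ψ => and (φ.subst σ) (ψ.subst σ)
  | _, _, σ, or φ ψ => or (φ.subst σ) (ψ.subst σ)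
  | _, _, σ, neg φ => neg (φ.subst σ)
  | _, _, σ, ex φ => ex (φ.subst (liftSubst σ))
  | _, _, σ, all φ => all (φ.subst (liftSubst σ))

def weaken {n : ℕ} (φ : Fml n) : Fml (n + 1) := φ.subst (fun i => Exp.var i.succ)

/-- `a ≥ b`. -/
def ge {n : ℕ} (a b : Exp n) : Fml n := or (gt a b) (eq a b)

/-- `e : nat`. -/
def isNat {n : ℕ} (e : Exp n) : Fml n := ge e (Exp.const 0)

end Fml

/-- Semantic entailment `𝒱 ; C ⊨ φ`: all assignments of natural numbers to the variables that
satisfy `C` satisfy `φ`. -/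
def Entails {n : ℕ} (C φ : Fml n) : Prop :=
  ∀ ρ : Fin n → ℕ, C.Holds (fun i => (ρ i : ℤ)) → φ.Holds (fun i => (ρ i : ℤ))

/-! ## Types -/

/-- Session types over `n` index variables. A type name is given by its arity `k` and its
identifier `V`. -/
inductive Ty : ℕ → Type
  /-- internal choice `⊕{ℓ : A_ℓ}` over `ℓ ∈ L` -/
  | ichoice {n : ℕ} (L : Finset Label) (A : L → Ty n) : Ty n
  /-- external choice `&{ℓ : A_ℓ}` over `ℓ ∈ L` -/
  | echoice {n : ℕ} (L : Finset Label) (A : L → Ty n) : Ty n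
  /-- `A ⊗ B` -/
  | tensor {n : ℕ} (A B : Ty n) : Ty n
  /-- `A ⊸ B` -/
  | lolli {n : ℕ} (A B : Ty n) : Ty n
  /-- the terminated session -/
  | one {n : ℕ} : Ty n
  /-- type name applied to index expressions -/
  | name {n : ℕ} (k V : ℕ) (e : Fin k → Exp n) : Ty n
  /-- `?{φ}. A`, the provider asserts `φ` -/
  | asserts {n : ℕ} (φ : Fml n) (A : Ty n) : Ty n
  /-- `!{φ}. A`, the provider assumes `φ` -/
  | assumes {n : ℕ} (φ : Fml n) (A : Ty n) : Ty n
  /-- `∃ n. A` -/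
  | ex {n : ℕ} (A : Ty (n + 1)) : Ty n
  /-- `∀ n. A` -/
  | all {n : ℕ} (A : Ty (n + 1)) : Ty n
  /-- `▷^r A`, the provider pays `r` units of potential -/
  | pays {n : ℕ} (r : Exp n) (A : Ty n) : Ty n
  /-- `◁^r A`, the provider gets `r` units of potential -/
  | gets {n : ℕ} (r : Exp n) (A : Ty n) : Ty n

namespace Ty

def subst : {n m : ℕ} → (Fin n → Exp m) → Ty n → Ty m
  | _, _, σ, ichoice L A => ichoice L (fun l => (A l).subst σ)
  | _, _, σ, echoice L A => echoice L (fun l => (A l).subst σ)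
  | _, _, σ, tensor A B => tensor (A.subst σ) (B.subst σ)
  | _, _, σ, lolli A B => lolli (A.subst σ) (B.subst σ)
  | _, _, _, one => one
  | _, _, σ, name k V e => name k V (fun i => (e i).subst σ)
  | _, _, σ, asserts φ A => asserts (φ.subst σ) (A.subst σ)
  | _, _, σ, assumes φ A => assumes (φ.subst σ) (A.subst σ)
  | _, _, σ, ex A => ex (A.subst (liftSubst σ))
  | _, _, σ, all A => all (A.subst (liftSubst σ))
  | _, _, σ, pays r A => pays (r.subst σ) (A.subst σ)
  | _, _, σ, gets r A => gets (r.subst σ) (A.subst σ)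

def weaken {n : ℕ} (A : Ty n) : Ty (n + 1) := A.subst (fun i => Exp.var i.succ)

/-- `A[e/n]` -/
def inst {n : ℕ} (A : Ty (n + 1)) (e : Exp n) : Ty n := A.subst (instSubst e)

def IsName {n : ℕ} : Ty n → Prop
  | name _ _ _ => True
  | _ => False

/-- The type constructors that involve communication. -/
def IsStructuralHead {n : ℕ} : Ty n → Prop
  | ichoice _ _ => True
  | echoice _ _ => True
  | tensor _ _ => True
  | lolli _ _ => True
  | one => True
  | ex _ => True
  | all _ => True
  | _ => False

end Ty

/-! ## Signatures -/

/-- Declaration `y₁ : B₁, …, yₘ : Bₘ ⊢^p f[n₁, …, n_k] :: (x : A)` of a defined process. The typing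
rules consult only the declaration of `f`, in which the channel names are bound. -/
structure PDecl (k : ℕ) where
  args : List (Ty k)
  pot : Exp k
  res : Ty k

/-- A signature: definitions `V[n₁, …, n_k] = A` of type names, and declarations of process names;
both kinds of names are given by an arity and an identifier. -/
structure Sig where
  tdef : (k : ℕ) → ℕ → Option (Ty k)
  pdecl : (k : ℕ) → ℕ → Option (PDecl k)

/-- Unfolding of type names at the head of a type (one step suffices in a contractive
signature). -/
def Sig.unfold (S : Sig) {n : ℕ} : Ty n → Ty n
  | .name k V e =>
    match S.tdef k V with
    | some A => A.subst e
    | none => .name k V e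
  | A => A

/-- `𝒱 ; C ⊢ A valid`: type names are declared, and every expression that denotes a natural number
(an index of a type name or a potential) can be proved to be one from the constraints known at its
occurrence. Scoping is intrinsic. -/
def Ty.Valid (S : Sig) : {n : ℕ} → Fml n → Ty n → Prop
  | _, C, .ichoice _ A => ∀ l, (A l).Valid S C
  | _, C, .echoice _ A => ∀ l, (A l).Valid S C
  | _, C, .tensor A B => A.Valid S C ∧ B.Valid S C
  | _, C, .lolli A B => A.Valid S C ∧ B.Valid S C
  | _, _, .one => True
  | _, C, .name k V e => (S.tdef k V).isSome ∧ ∀ i, Entails C (.isNat (e i))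
  | _, C, .asserts φ A => A.Valid S (C.and φ)
  | _, C, .assumes φ A => A.Valid S (C.and φ)
  | _, C, .ex A => A.Valid S C.weaken
  | _, C, .all A => A.Valid S C.weaken
  | _, C, .pays r A => Entails C (.isNat r) ∧ A.Valid S C
  | _, C, .gets r A => Entails C (.isNat r) ∧ A.Valid S C

/-! ## Polarity -/

/-- `S`: structural types, up to unfolding of type names. -/
def Structural (S : Sig) {n : ℕ} (A : Ty n) : Prop := (S.unfold A).IsStructuralHead

/-- `A⁺ ::= S | ?{φ} A⁺ | ▷^r A⁺`, up to unfolding of type names. -/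
inductive Positive (S : Sig) {n : ℕ} : Ty n → Prop
  | structural {A : Ty n} : Structural S A → Positive S A
  | asserts {A A' : Ty n} {φ : Fml n} :
      S.unfold A = .asserts φ A' → Positive S A' → Positive S A
  | pays {A A' : Ty n} {r : Exp n} :
      S.unfold A = .pays r A' → Positive S A' → Positive S A

/-- `A⁻ ::= S | !{φ} A⁻ | ◁^r A⁻`, up to unfolding of type names. -/
inductive Negative (S : Sig) {n : ℕ} : Ty n → Prop
  | structural {A : Ty n} : Structural S A → Negative S A
  | assumes {A A' : Ty n} {φ : Fml n} :
      S.unfold A = .assumes φ A' → Negative S A' → Negative S A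
  | gets {A A' : Ty n} {r : Exp n} :
      S.unfold A = .gets r A' → Negative S A' → Negative S A

/-- Polarized types: `A ::= A⁺ | A⁻`, hereditarily, where the channels that are passed have
structural type (`S ⊗ A` and `S ⊸ A`). -/
def Ty.Polarized (S : Sig) : {n : ℕ} → Ty n → Prop
  | _, .ichoice _ A => ∀ l, (A l).Polarized S
  | _, .echoice _ A => ∀ l, (A l).Polarized S
  | _, .tensor A B => Structural S A ∧ A.Polarized S ∧ B.Polarized S
  | _, .lolli A B => Structural S A ∧ A.Polarized S ∧ B.Polarized S
  | _, .one => True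
  | _, .name k V e => Positive S (.name k V e) ∨ Negative S (.name k V e)
  | _, .asserts φ A => Positive S (.asserts φ A) ∧ A.Polarized S
  | _, .assumes φ A => Negative S (.assumes φ A) ∧ A.Polarized S
  | _, .ex A => A.Polarized S
  | _, .all A => A.Polarized S
  | _, .pays r A => Positive S (.pays r A) ∧ A.Polarized S
  | _, .gets r A => Negative S (.gets r A) ∧ A.Polarized S

/-- Well-formed signatures: type definitions are contractive, valid and polarized; the types in
process declarations are valid, polarized, and structural at the top level. -/
structure Sig.WellFormed (S : Sig) : Prop where
  contractive : ∀ {k V : ℕ} {A : Ty k}, S.tdef k V = some A → ¬ A.IsName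
  valid : ∀ {k V : ℕ} {A : Ty k}, S.tdef k V = some A → A.Valid S .tt
  polarized : ∀ {k V : ℕ} {A : Ty k}, S.tdef k V = some A → A.Polarized S
  decl : ∀ {k f : ℕ} {D : PDecl k}, S.pdecl k f = some D → ∀ A ∈ D.res :: D.args,
    A.Valid S .tt ∧ A.Polarized S ∧ Structural S A

/-! ## Type equality -/

/-- One step of the bisimulation condition, for types whose head has been unfolded. -/
def HeadMatch (R : Ty 0 → Ty 0 → Prop) : Ty 0 → Ty 0 → Prop
  | .ichoice L A, .ichoice L' B => L = L' ∧ ∀ l (h : l ∈ L) (h' : l ∈ L'), R (A ⟨l, h⟩) (B ⟨l, h'⟩)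
  | .echoice L A, .echoice L' B => L = L' ∧ ∀ l (h : l ∈ L) (h' : l ∈ L'), R (A ⟨l, h⟩) (B ⟨l, h'⟩)
  | .tensor A₁ A₂, .tensor B₁ B₂ => R A₁ B₁ ∧ R A₂ B₂
  | .lolli A₁ A₂, .lolli B₁ B₂ => R A₁ B₁ ∧ R A₂ B₂
  | .one, .one => True
  | .asserts φ A, .asserts ψ B =>
      (Entails .tt φ ∧ Entails .tt ψ ∧ R A B) ∨ (Entails .tt φ.neg ∧ Entails .tt ψ.neg)
  | .assumes φ A, .assumes ψ B =>
      (Entails .tt φ ∧ Entails .tt ψ ∧ R A B) ∨ (Entails .tt φ.neg ∧ Entails .tt ψ.neg)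
  | .ex A, .ex B => ∀ i : ℕ, R (A.inst (.const i)) (B.inst (.const i))
  | .all A, .all B => ∀ i : ℕ, R (A.inst (.const i)) (B.inst (.const i))
  | .pays r A, .pays s B => Entails .tt (.eq r s) ∧ R A B
  | .gets r A, .gets s B => Entails .tt (.eq r s) ∧ R A B
  | _, _ => False

/-- Type bisimulations on closed types. -/
def IsTypeBisimulation (S : Sig) (R : Ty 0 → Ty 0 → Prop) : Prop :=
  ∀ A B, R A B → HeadMatch R (S.unfold A) (S.unfold B)

/-- `A ≡ B` for closed types. -/
def ClosedTyEq (S : Sig) (A B : Ty 0) : Prop := ∃ R, IsTypeBisimulation S R ∧ R A B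

/-- `∀ 𝒱. C ⇒ A ≡ B`: equality under all ground substitutions that satisfy `C`. -/
def TyEq (S : Sig) {n : ℕ} (C : Fml n) (A B : Ty n) : Prop :=
  ∀ ρ : Fin n → ℕ, C.Holds (fun i => (ρ i : ℤ)) →
    ClosedTyEq S (A.subst (fun i => .const (ρ i))) (B.subst (fun i => .const (ρ i)))

/-! ## Program terms -/

/-- Programs over `n` index variables. Channel variables are named. Source programs (implicit
syntax) are those without the last four constructs. -/
inductive Proc : ℕ → Type
  /-- `x ← y` -/
  | fwd {n : ℕ} (x y : Chan) : Proc n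
  /-- `x ← f[e] ys ; Q`, where `f` is given by its arity `k` and identifier `f`; binds `x` in `Q` -/
  | spawn {n : ℕ} (x : Chan) (k f : ℕ) (e : Fin k → Exp n) (ys : List Chan) (Q : Proc n) : Proc n
  /-- `x.l ; P` -/
  | sendl {n : ℕ} (x : Chan) (l : Label) (P : Proc n) : Proc n
  /-- `case x (ℓ ⇒ P_ℓ)` for `ℓ ∈ L` -/
  | case {n : ℕ} (x : Chan) (L : Finset Label) (P : L → Proc n) : Proc n
  /-- `send x w ; P` -/
  | send {n : ℕ} (x w : Chan) (P : Proc n) : Proc n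
  /-- `y ← recv x ; P`, binds `y` in `P` -/
  | recv {n : ℕ} (x y : Chan) (P : Proc n) : Proc n
  /-- `close x` -/
  | close {n : ℕ} (x : Chan) : Proc n
  /-- `wait x ; P` -/
  | wait {n : ℕ} (x : Chan) (P : Proc n) : Proc n
  /-- `send x {e} ; P` -/
  | sendn {n : ℕ} (x : Chan) (e : Exp n) (P : Proc n) : Proc n
  /-- `{n} ← recv x ; P`, binds an index variable in `P` -/
  | recvn {n : ℕ} (x : Chan) (P : Proc (n + 1)) : Proc n
  /-- `work {r} ; P` -/
  | work {n : ℕ} (r : Exp n) (P : Proc n) : Proc n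
  /-- `impossible` -/
  | impossible {n : ℕ} : Proc n
  /-- `assert x {φ} ; P` -/
  | asserts {n : ℕ} (x : Chan) (φ : Fml n) (P : Proc n) : Proc n
  /-- `assume x {φ} ; P` -/
  | assumes {n : ℕ} (x : Chan) (φ : Fml n) (P : Proc n) : Proc n
  /-- `pay x {r} ; P` -/
  | pays {n : ℕ} (x : Chan) (r : Exp n) (P : Proc n) : Proc n
  /-- `get x {r} ; P` -/
  | gets {n : ℕ} (x : Chan) (r : Exp n) (P : Proc n) : Proc n

namespace Proc

/-- Erasure of the constructs `assert`, `assume`, `pay` and `get`. -/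
def erase : {n : ℕ} → Proc n → Proc n
  | _, fwd x y => fwd x y
  | _, spawn x k f e ys Q => spawn x k f e ys Q.erase
  | _, sendl x l P => sendl x l P.erase
  | _, case x L P => case x L (fun l => (P l).erase)
  | _, send x w P => send x w P.erase
  | _, recv x y P => recv x y P.erase
  | _, close x => close x
  | _, wait x P => wait x P.erase
  | _, sendn x e P => sendn x e P.erase
  | _, recvn x P => recvn x P.erase
  | _, work r P => work r P.erase
  | _, impossible => impossible
  | _, asserts _ _ P => P.erase
  | _, assumes _ _ P => P.erase
  | _, pays _ _ P => P.erase
  | _, gets _ _ P => P.erase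

/-- The channel along which the program communicates in its first action. -/
def subject {n : ℕ} : Proc n → Option Chan
  | fwd x _ => some x
  | sendl x _ _ => some x
  | case x _ _ => some x
  | send x _ _ => some x
  | recv x _ _ => some x
  | close x => some x
  | wait x _ => some x
  | sendn x _ _ => some x
  | recvn x _ => some x
  | _ => none

/-- The channels that the first action hands over or identifies with its subject. -/
def objects {n : ℕ} : Proc n → List Chan
  | fwd _ y => [y]
  | send _ w _ => [w]
  | spawn _ _ _ _ ys _ => ys
  | _ => []

end Proc

/-! ## Contexts -/

/-- Linear contexts. -/
abbrev Ctx (n : ℕ) := Multiset (Chan × Ty n)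

/-- The same context in the presence of one more index variable. -/
def Ctx.weaken {n : ℕ} (Δ : Ctx n) : Ctx (n + 1) := Δ.map (fun p => (p.1, p.2.weaken))

/-- `y` does not occur in `Δ`. -/
def Fresh {n : ℕ} (y : Chan) (Δ : Ctx n) : Prop := ∀ p ∈ Δ, p.1 ≠ y

/-- All channels in the sequent with antecedents `Δ` and succedent channel `x` are distinct. -/
def Distinct {n : ℕ} (Δ : Ctx n) (x : Chan) : Prop := (Δ.map Prod.fst).Nodup ∧ Fresh x Δ

/-- The antecedents `D = (y₁ : A₁), …` match the channels `ys` and the declared types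
`B₁[e], …` in the invocation of a process. -/
def MatchArgs (S : Sig) {n k : ℕ} (C : Fml n) (D : List (Chan × Ty n)) (ys : List Chan)
    (e : Fin k → Exp n) (Bs : List (Ty k)) : Prop :=
  D.map Prod.fst = ys ∧ List.Forall₂ (fun d B => TyEq S C d.2 (B.subst e)) D Bs

/-! ## Explicit and implicit typing -/

inductive Mode
  | implicit
  | explicit

/-- `Typed S m C Δ q P x A` is the judgment `𝒱 ; C ; Δ ⊢^q P :: (x : A)` of the explicit
(`m = .explicit`) or the implicit (`m = .implicit`) type system. The two systems share all rules
except those for `?`, `!`, `▷` and `◁`, which leave the program unchanged in the implicit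
system. Type names are unfolded silently, and bound channel names are chosen fresh. -/
inductive Typed (S : Sig) (m : Mode) :
    {n : ℕ} → Fml n → Ctx n → Exp n → Proc n → Chan → Ty n → Prop
  | id {n : ℕ} {C : Fml n} {q : Exp n} {x y : Chan} {A B : Ty n} :
      Entails C (.eq q (.const 0)) → TyEq S C A B →
      Typed S m C {(y, A)} q (.fwd x y) x B
  | spawn {n : ℕ} {C : Fml n} {Δ : Ctx n} {D : List (Chan × Ty n)} {r : Exp n} {x z : Chan}
      {k f : ℕ} {e : Fin k → Exp n} {ys : List Chan} {Q : Proc n} {Z : Ty n} {F : PDecl k} :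
      S.pdecl k f = some F → (∀ i, Entails C (.isNat (e i))) →
      Entails C (.ge r (F.pot.subst e)) → MatchArgs S C D ys e F.args →
      Fresh x Δ → x ≠ z →
      Typed S m C ((x, F.res.subst e) ::ₘ Δ) (.sub r (F.pot.subst e)) Q z Z →
      Typed S m C ((D : Ctx n) + Δ) r (.spawn x k f e ys Q) z Z
  | ichoiceR {n : ℕ} {C : Fml n} {Δ : Ctx n} {q : Exp n} {P : Proc n} {x : Chan} {A : Ty n}
      {L : Finset Label} {As : L → Ty n} (l : L) :
      S.unfold A = .ichoice L As → Typed S m C Δ q P x (As l) →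
      Typed S m C Δ q (.sendl x l P) x A
  | ichoiceL {n : ℕ} {C : Fml n} {Δ : Ctx n} {q : Exp n} {x z : Chan} {A Z : Ty n}
      {L : Finset Label} {As : L → Ty n} {Q : L → Proc n} :
      S.unfold A = .ichoice L As → (∀ l, Typed S m C ((x, As l) ::ₘ Δ) q (Q l) z Z) →
      Typed S m C ((x, A) ::ₘ Δ) q (.case x L Q) z Z
  | echoiceR {n : ℕ} {C : Fml n} {Δ : Ctx n} {q : Exp n} {x : Chan} {A : Ty n}
      {L : Finset Label} {As : L → Ty n} {P : L → Proc n} :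
      S.unfold A = .echoice L As → (∀ l, Typed S m C Δ q (P l) x (As l)) →
      Typed S m C Δ q (.case x L P) x A
  | echoiceL {n : ℕ} {C : Fml n} {Δ : Ctx n} {q : Exp n} {Q : Proc n} {x z : Chan} {A Z : Ty n}
      {L : Finset Label} {As : L → Ty n} (l : L) :
      S.unfold A = .echoice L As → Typed S m C ((x, As l) ::ₘ Δ) q Q z Z →
      Typed S m C ((x, A) ::ₘ Δ) q (.sendl x l Q) z Z
  | tensorR {n : ℕ} {C : Fml n} {Δ : Ctx n} {q : Exp n} {P : Proc n} {x w : Chan}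
      {A A₁ A₂ B : Ty n} :
      S.unfold A = .tensor A₂ B → TyEq S C A₁ A₂ → Typed S m C Δ q P x B →
      Typed S m C ((w, A₁) ::ₘ Δ) q (.send x w P) x A
  | tensorL {n : ℕ} {C : Fml n} {Δ : Ctx n} {q : Exp n} {Q : Proc n} {x y z : Chan}
      {A A₁ B Z : Ty n} :
      S.unfold A = .tensor A₁ B → Fresh y Δ → y ≠ x → y ≠ z →
      Typed S m C ((y, A₁) ::ₘ (x, B) ::ₘ Δ) q Q z Z →
      Typed S m C ((x, A) ::ₘ Δ) q (.recv x y Q) z Z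
  | lolliR {n : ℕ} {C : Fml n} {Δ : Ctx n} {q : Exp n} {P : Proc n} {x y : Chan}
      {A A₁ B : Ty n} :
      S.unfold A = .lolli A₁ B → Fresh y Δ → y ≠ x →
      Typed S m C ((y, A₁) ::ₘ Δ) q P x B →
      Typed S m C Δ q (.recv x y P) x A
  | lolliL {n : ℕ} {C : Fml n} {Δ : Ctx n} {q : Exp n} {Q : Proc n} {x w z : Chan}
      {A A₁ A₂ B Z : Ty n} :
      S.unfold A = .lolli A₂ B → TyEq S C A₁ A₂ → Typed S m C ((x, B) ::ₘ Δ) q Q z Z →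
      Typed S m C ((w, A₁) ::ₘ (x, A) ::ₘ Δ) q (.send x w Q) z Z
  | oneR {n : ℕ} {C : Fml n} {q : Exp n} {x : Chan} {A : Ty n} :
      S.unfold A = .one → Entails C (.eq q (.const 0)) →
      Typed S m C 0 q (.close x) x A
  | oneL {n : ℕ} {C : Fml n} {Δ : Ctx n} {q : Exp n} {Q : Proc n} {x z : Chan} {A Z : Ty n} :
      S.unfold A = .one → Typed S m C Δ q Q z Z →
      Typed S m C ((x, A) ::ₘ Δ) q (.wait x Q) z Z
  | exR {n : ℕ} {C : Fml n} {Δ : Ctx n} {q e : Exp n} {P : Proc n} {x : Chan} {A : Ty n}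
      {A' : Ty (n + 1)} :
      S.unfold A = .ex A' → Entails C (.isNat e) → Typed S m C Δ q P x (A'.inst e) →
      Typed S m C Δ q (.sendn x e P) x A
  | exL {n : ℕ} {C : Fml n} {Δ : Ctx n} {q : Exp n} {Q : Proc (n + 1)} {x z : Chan} {A Z : Ty n}
      {A' : Ty (n + 1)} :
      S.unfold A = .ex A' →
      Typed S m C.weaken ((x, A') ::ₘ Δ.weaken) q.weaken Q z Z.weaken →
      Typed S m C ((x, A) ::ₘ Δ) q (.recvn x Q) z Z
  | allR {n : ℕ} {C : Fml n} {Δ : Ctx n} {q : Exp n} {P : Proc (n + 1)} {x : Chan} {A : Ty n}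
      {A' : Ty (n + 1)} :
      S.unfold A = .all A' → Typed S m C.weaken Δ.weaken q.weaken P x A' →
      Typed S m C Δ q (.recvn x P) x A
  | allL {n : ℕ} {C : Fml n} {Δ : Ctx n} {q e : Exp n} {Q : Proc n} {x z : Chan} {A Z : Ty n}
      {A' : Ty (n + 1)} :
      S.unfold A = .all A' → Entails C (.isNat e) →
      Typed S m C ((x, A'.inst e) ::ₘ Δ) q Q z Z →
      Typed S m C ((x, A) ::ₘ Δ) q (.sendn x e Q) z Z
  | work {n : ℕ} {C : Fml n} {Δ : Ctx n} {q r : Exp n} {P : Proc n} {x : Chan} {A : Ty n} :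
      Entails C (.ge q r) → Typed S m C Δ (.sub q r) P x A →
      Typed S m C Δ q (.work r P) x A
  | unsat {n : ℕ} {C : Fml n} {Δ : Ctx n} {q : Exp n} {x : Chan} {A : Ty n} :
      Entails C .ff → Typed S m C Δ q .impossible x A
  -- implicit rules for constraints and potential
  | assertsR {n : ℕ} {C φ : Fml n} {Δ : Ctx n} {q : Exp n} {P : Proc n} {x : Chan}
      {A A' : Ty n} :
      m = .implicit → S.unfold A = .asserts φ A' → Entails C φ →
      Typed S m C Δ q P x A' → Typed S m C Δ q P x A
  | assertsL {n : ℕ} {C φ : Fml n} {Δ : Ctx n} {q : Exp n} {Q : Proc n} {x z : Chan}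
      {A A' Z : Ty n} :
      m = .implicit → S.unfold A = .asserts φ A' →
      Typed S m (C.and φ) ((x, A') ::ₘ Δ) q Q z Z → Typed S m C ((x, A) ::ₘ Δ) q Q z Z
  | assumesR {n : ℕ} {C φ : Fml n} {Δ : Ctx n} {q : Exp n} {P : Proc n} {x : Chan}
      {A A' : Ty n} :
      m = .implicit → S.unfold A = .assumes φ A' →
      Typed S m (C.and φ) Δ q P x A' → Typed S m C Δ q P x A
  | assumesL {n : ℕ} {C φ : Fml n} {Δ : Ctx n} {q : Exp n} {Q : Proc n} {x z : Chan}
      {A A' Z : Ty n} :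
      m = .implicit → S.unfold A = .assumes φ A' → Entails C φ →
      Typed S m C ((x, A') ::ₘ Δ) q Q z Z → Typed S m C ((x, A) ::ₘ Δ) q Q z Z
  | paysR {n : ℕ} {C : Fml n} {Δ : Ctx n} {q r : Exp n} {P : Proc n} {x : Chan} {A A' : Ty n} :
      m = .implicit → S.unfold A = .pays r A' → Entails C (.ge q r) →
      Typed S m C Δ (.sub q r) P x A' → Typed S m C Δ q P x A
  | paysL {n : ℕ} {C : Fml n} {Δ : Ctx n} {q r : Exp n} {Q : Proc n} {x z : Chan}
      {A A' Z : Ty n} :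
      m = .implicit → S.unfold A = .pays r A' →
      Typed S m C ((x, A') ::ₘ Δ) (.add q r) Q z Z → Typed S m C ((x, A) ::ₘ Δ) q Q z Z
  | getsR {n : ℕ} {C : Fml n} {Δ : Ctx n} {q r : Exp n} {P : Proc n} {x : Chan} {A A' : Ty n} :
      m = .implicit → S.unfold A = .gets r A' →
      Typed S m C Δ (.add q r) P x A' → Typed S m C Δ q P x A
  | getsL {n : ℕ} {C : Fml n} {Δ : Ctx n} {q r : Exp n} {Q : Proc n} {x z : Chan}
      {A A' Z : Ty n} :
      m = .implicit → S.unfold A = .gets r A' → Entails C (.ge q r) →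
      Typed S m C ((x, A') ::ₘ Δ) (.sub q r) Q z Z → Typed S m C ((x, A) ::ₘ Δ) q Q z Z
  -- explicit rules for constraints and potential
  | assertsR' {n : ℕ} {C φ φ' : Fml n} {Δ : Ctx n} {q : Exp n} {P : Proc n} {x : Chan}
      {A A' : Ty n} :
      m = .explicit → S.unfold A = .asserts φ' A' → Entails C φ → Entails C φ' →
      Typed S m C Δ q P x A' → Typed S m C Δ q (.asserts x φ P) x A
  | assertsL' {n : ℕ} {C φ φ' : Fml n} {Δ : Ctx n} {q : Exp n} {Q : Proc n} {x z : Chan}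
      {A A' Z : Ty n} :
      m = .explicit → S.unfold A = .asserts φ' A' → Entails (C.and φ') φ →
      Typed S m (C.and φ) ((x, A') ::ₘ Δ) q Q z Z →
      Typed S m C ((x, A) ::ₘ Δ) q (.assumes x φ Q) z Z
  | assumesR' {n : ℕ} {C φ φ' : Fml n} {Δ : Ctx n} {q : Exp n} {P : Proc n} {x : Chan}
      {A A' : Ty n} :
      m = .explicit → S.unfold A = .assumes φ' A' → Entails (C.and φ') φ →
      Typed S m (C.and φ) Δ q P x A' → Typed S m C Δ q (.assumes x φ P) x A
  | assumesL' {n : ℕ} {C φ φ' : Fml n} {Δ : Ctx n} {q : Exp n} {Q : Proc n} {x z : Chan}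
      {A A' Z : Ty n} :
      m = .explicit → S.unfold A = .assumes φ' A' → Entails C φ → Entails C φ' →
      Typed S m C ((x, A') ::ₘ Δ) q Q z Z →
      Typed S m C ((x, A) ::ₘ Δ) q (.asserts x φ Q) z Z
  | paysR' {n : ℕ} {C : Fml n} {Δ : Ctx n} {q r r' : Exp n} {P : Proc n} {x : Chan}
      {A A' : Ty n} :
      m = .explicit → S.unfold A = .pays r' A' → Entails C (.ge q r) → Entails C (.eq r r') →
      Typed S m C Δ (.sub q r) P x A' → Typed S m C Δ q (.pays x r P) x A
  | paysL' {n : ℕ} {C : Fml n} {Δ : Ctx n} {q r r' : Exp n} {Q : Proc n} {x z : Chan}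
      {A A' Z : Ty n} :
      m = .explicit → S.unfold A = .pays r' A' → Entails C (.eq r r') →
      Typed S m C ((x, A') ::ₘ Δ) (.add q r) Q z Z →
      Typed S m C ((x, A) ::ₘ Δ) q (.gets x r Q) z Z
  | getsR' {n : ℕ} {C : Fml n} {Δ : Ctx n} {q r r' : Exp n} {P : Proc n} {x : Chan}
      {A A' : Ty n} :
      m = .explicit → S.unfold A = .gets r' A' → Entails C (.eq r r') →
      Typed S m C Δ (.add q r) P x A' → Typed S m C Δ q (.gets x r P) x A
  | getsL' {n : ℕ} {C : Fml n} {Δ : Ctx n} {q r r' : Exp n} {Q : Proc n} {x z : Chan}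
      {A A' Z : Ty n} :
      m = .explicit → S.unfold A = .gets r' A' → Entails C (.ge q r) → Entails C (.eq r r') →
      Typed S m C ((x, A') ::ₘ Δ) (.sub q r) Q z Z →
      Typed S m C ((x, A) ::ₘ Δ) q (.pays x r Q) z Z

/-- The implicit type system. -/
abbrev ImplicitTyped (S : Sig) {n : ℕ} (C : Fml n) (Δ : Ctx n) (q : Exp n) (P : Proc n)
    (x : Chan) (A : Ty n) : Prop := Typed S .implicit C Δ q P x A

/-- The explicit type system. -/
abbrev ExplicitTyped (S : Sig) {n : ℕ} (C : Fml n) (Δ : Ctx n) (q : Exp n) (P : Proc n)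
    (x : Chan) (A : Ty n) : Prop := Typed S .explicit C Δ q P x A

/-! ## The forcing calculus -/

/-- The part of a forcing sequent besides the stable linear context `Δ⁻`:
* `inv Ω`: nothing is forced, and `Ω` is the ordered context. The head of the list is the right
  end of `Ω`, where the rules apply;
* `left x A`: `Ω` is empty and the antecedent `[x : A]` is forced;
* `right`: `Ω` is empty and the succedent is forced. -/
inductive Stage (n : ℕ)
  | inv (Ω : List (Chan × Ty n))
  | left (x : Chan) (A : Ty n)
  | right

/-- The forcing calculus, with judgments
* `Forcing S C Δ (.inv Ω) q P x A`: `𝒱 ; C ; Δ⁻ ; Ω ⊢^q P :: (x : A)`,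
* `Forcing S C Δ (.left y B) q P x A`: `𝒱 ; C ; Δ⁻, [y : B] ; · ⊢^q P :: (x : A)`,
* `Forcing S C Δ .right q P x A`: `𝒱 ; C ; Δ⁻ ; · ⊢^q P :: [x : A]`. -/
inductive Forcing (S : Sig) :
    {n : ℕ} → Fml n → Ctx n → Stage n → Exp n → Proc n → Chan → Ty n → Prop
  -- inversion: `assume` and `get` are inserted eagerly, first on the right, then on the left
  | assumesR {n : ℕ} {C φ : Fml n} {Δ : Ctx n} {Ω : List (Chan × Ty n)} {q : Exp n} {P : Proc n}
      {x : Chan} {A A' : Ty n} :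
      S.unfold A = .assumes φ A' →
      Forcing S (C.and φ) Δ (.inv Ω) q P x A' → Forcing S C Δ (.inv Ω) q P x A
  | getsR {n : ℕ} {C : Fml n} {Δ : Ctx n} {Ω : List (Chan × Ty n)} {q r : Exp n} {P : Proc n}
      {x : Chan} {A A' : Ty n} :
      S.unfold A = .gets r A' →
      Forcing S C Δ (.inv Ω) (.add q r) P x A' → Forcing S C Δ (.inv Ω) q P x A
  | assertsL {n : ℕ} {C φ : Fml n} {Δ : Ctx n} {Ω : List (Chan × Ty n)} {q : Exp n} {P : Proc n}
      {x z : Chan} {A A' Z : Ty n} :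
      Positive S Z → S.unfold A = .asserts φ A' →
      Forcing S (C.and φ) Δ (.inv ((x, A') :: Ω)) q P z Z →
      Forcing S C Δ (.inv ((x, A) :: Ω)) q P z Z
  | paysL {n : ℕ} {C : Fml n} {Δ : Ctx n} {Ω : List (Chan × Ty n)} {q r : Exp n} {P : Proc n}
      {x z : Chan} {A A' Z : Ty n} :
      Positive S Z → S.unfold A = .pays r A' →
      Forcing S C Δ (.inv ((x, A') :: Ω)) (.add q r) P z Z →
      Forcing S C Δ (.inv ((x, A) :: Ω)) q P z Z
  | move {n : ℕ} {C : Fml n} {Δ : Ctx n} {Ω : List (Chan × Ty n)} {q : Exp n} {P : Proc n}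
      {x z : Chan} {A Z : Ty n} :
      Positive S Z → Negative S A →
      Forcing S C ((x, A) ::ₘ Δ) (.inv Ω) q P z Z →
      Forcing S C Δ (.inv ((x, A) :: Ω)) q P z Z
  -- in a stable sequent, force a channel that takes part in the next action
  | forceR {n : ℕ} {C : Fml n} {Δ : Ctx n} {q : Exp n} {P : Proc n} {x : Chan} {A : Ty n} :
      Positive S A → P.subject = some x →
      Forcing S C Δ .right q P x A → Forcing S C Δ (.inv []) q P x A
  | forceL {n : ℕ} {C : Fml n} {Δ : Ctx n} {q : Exp n} {P : Proc n} {y z : Chan} {B Z : Ty n} :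
      Positive S Z → (P.subject = some y ∨ y ∈ P.objects) →
      Forcing S C Δ (.left y B) q P z Z → Forcing S C ((y, B) ::ₘ Δ) (.inv []) q P z Z
  -- `assert` and `pay` are inserted lazily, on the forced channel
  | assertsR {n : ℕ} {C φ : Fml n} {Δ : Ctx n} {q : Exp n} {P : Proc n} {x : Chan} {A A' : Ty n} :
      S.unfold A = .asserts φ A' → Entails C φ →
      Forcing S C Δ .right q P x A' → Forcing S C Δ .right q P x A
  | paysR {n : ℕ} {C : Fml n} {Δ : Ctx n} {q r : Exp n} {P : Proc n} {x : Chan} {A A' : Ty n} :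
      S.unfold A = .pays r A' → Entails C (.ge q r) →
      Forcing S C Δ .right (.sub q r) P x A' → Forcing S C Δ .right q P x A
  | assumesL {n : ℕ} {C φ : Fml n} {Δ : Ctx n} {q : Exp n} {P : Proc n} {y z : Chan}
      {B B' Z : Ty n} :
      S.unfold B = .assumes φ B' → Entails C φ →
      Forcing S C Δ (.left y B') q P z Z → Forcing S C Δ (.left y B) q P z Z
  | getsL {n : ℕ} {C : Fml n} {Δ : Ctx n} {q r : Exp n} {P : Proc n} {y z : Chan}
      {B B' Z : Ty n} :
      S.unfold B = .gets r B' → Entails C (.ge q r) →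
      Forcing S C Δ (.left y B') (.sub q r) P z Z → Forcing S C Δ (.left y B) q P z Z
  /-- A channel that is handed over loses the forcing once its type is structural. -/
  | unforce {n : ℕ} {C : Fml n} {Δ : Ctx n} {q : Exp n} {P : Proc n} {y z : Chan} {B Z : Ty n} :
      Structural S B → y ∈ P.objects →
      Forcing S C ((y, B) ::ₘ Δ) (.inv []) q P z Z → Forcing S C Δ (.left y B) q P z Z
  -- structural rules; the subject of the action is forced and loses the forcing
  | id {n : ℕ} {C : Fml n} {q : Exp n} {x y : Chan} {A B : Ty n} :
      Structural S A → Structural S B →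
      Entails C (.eq q (.const 0)) → TyEq S C A B →
      Forcing S C {(y, A)} .right q (.fwd x y) x B
  | ichoiceR {n : ℕ} {C : Fml n} {Δ : Ctx n} {q : Exp n} {P : Proc n} {x : Chan} {A : Ty n}
      {L : Finset Label} {As : L → Ty n} (l : L) :
      S.unfold A = .ichoice L As → Forcing S C Δ (.inv []) q P x (As l) →
      Forcing S C Δ .right q (.sendl x l P) x A
  | ichoiceL {n : ℕ} {C : Fml n} {Δ : Ctx n} {q : Exp n} {x z : Chan} {A Z : Ty n}
      {L : Finset Label} {As : L → Ty n} {Q : L → Proc n} :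
      Positive S Z → S.unfold A = .ichoice L As →
      (∀ l, Forcing S C Δ (.inv [(x, As l)]) q (Q l) z Z) →
      Forcing S C Δ (.left x A) q (.case x L Q) z Z
  | echoiceR {n : ℕ} {C : Fml n} {Δ : Ctx n} {q : Exp n} {x : Chan} {A : Ty n}
      {L : Finset Label} {As : L → Ty n} {P : L → Proc n} :
      S.unfold A = .echoice L As → (∀ l, Forcing S C Δ (.inv []) q (P l) x (As l)) →
      Forcing S C Δ .right q (.case x L P) x A
  | echoiceL {n : ℕ} {C : Fml n} {Δ : Ctx n} {q : Exp n} {Q : Proc n} {x z : Chan} {A Z : Ty n}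
      {L : Finset Label} {As : L → Ty n} (l : L) :
      Positive S Z → S.unfold A = .echoice L As →
      Forcing S C Δ (.inv [(x, As l)]) q Q z Z →
      Forcing S C Δ (.left x A) q (.sendl x l Q) z Z
  | tensorR {n : ℕ} {C : Fml n} {Δ : Ctx n} {q : Exp n} {P : Proc n} {x w : Chan}
      {A A₁ A₂ B : Ty n} :
      S.unfold A = .tensor A₂ B → Structural S A₁ → TyEq S C A₁ A₂ →
      Forcing S C Δ (.inv []) q P x B →
      Forcing S C ((w, A₁) ::ₘ Δ) .right q (.send x w P) x A
  | tensorL {n : ℕ} {C : Fml n} {Δ : Ctx n} {q : Exp n} {Q : Proc n} {x y z : Chan}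
      {A A₁ B Z : Ty n} :
      Positive S Z → S.unfold A = .tensor A₁ B → Fresh y Δ → y ≠ x → y ≠ z →
      Forcing S C Δ (.inv [(y, A₁), (x, B)]) q Q z Z →
      Forcing S C Δ (.left x A) q (.recv x y Q) z Z
  | lolliR {n : ℕ} {C : Fml n} {Δ : Ctx n} {q : Exp n} {P : Proc n} {x y : Chan}
      {A A₁ B : Ty n} :
      S.unfold A = .lolli A₁ B → Fresh y Δ → y ≠ x →
      Forcing S C Δ (.inv [(y, A₁)]) q P x B →
      Forcing S C Δ .right q (.recv x y P) x A
  | lolliL {n : ℕ} {C : Fml n} {Δ : Ctx n} {q : Exp n} {Q : Proc n} {x w z : Chan}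
      {A A₁ A₂ B Z : Ty n} :
      Positive S Z → S.unfold A = .lolli A₂ B → Structural S A₁ → TyEq S C A₁ A₂ →
      Forcing S C Δ (.inv [(x, B)]) q Q z Z →
      Forcing S C ((w, A₁) ::ₘ Δ) (.left x A) q (.send x w Q) z Z
  | oneR {n : ℕ} {C : Fml n} {q : Exp n} {x : Chan} {A : Ty n} :
      S.unfold A = .one → Entails C (.eq q (.const 0)) →
      Forcing S C 0 .right q (.close x) x A
  | oneL {n : ℕ} {C : Fml n} {Δ : Ctx n} {q : Exp n} {Q : Proc n} {x z : Chan} {A Z : Ty n} :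
      Positive S Z → S.unfold A = .one → Forcing S C Δ (.inv []) q Q z Z →
      Forcing S C Δ (.left x A) q (.wait x Q) z Z
  | exR {n : ℕ} {C : Fml n} {Δ : Ctx n} {q e : Exp n} {P : Proc n} {x : Chan} {A : Ty n}
      {A' : Ty (n + 1)} :
      S.unfold A = .ex A' → Entails C (.isNat e) →
      Forcing S C Δ (.inv []) q P x (A'.inst e) →
      Forcing S C Δ .right q (.sendn x e P) x A
  | exL {n : ℕ} {C : Fml n} {Δ : Ctx n} {q : Exp n} {Q : Proc (n + 1)} {x z : Chan} {A Z : Ty n}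
      {A' : Ty (n + 1)} :
      Positive S Z → S.unfold A = .ex A' →
      Forcing S C.weaken Δ.weaken (.inv [(x, A')]) q.weaken Q z Z.weaken →
      Forcing S C Δ (.left x A) q (.recvn x Q) z Z
  | allR {n : ℕ} {C : Fml n} {Δ : Ctx n} {q : Exp n} {P : Proc (n + 1)} {x : Chan} {A : Ty n}
      {A' : Ty (n + 1)} :
      S.unfold A = .all A' → Forcing S C.weaken Δ.weaken (.inv []) q.weaken P x A' →
      Forcing S C Δ .right q (.recvn x P) x A
  | allL {n : ℕ} {C : Fml n} {Δ : Ctx n} {q e : Exp n} {Q : Proc n} {x z : Chan} {A Z : Ty n}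
      {A' : Ty (n + 1)} :
      Positive S Z → S.unfold A = .all A' → Entails C (.isNat e) →
      Forcing S C Δ (.inv [(x, A'.inst e)]) q Q z Z →
      Forcing S C Δ (.left x A) q (.sendn x e Q) z Z
  -- actions without a subject, in stable sequents
  | spawn {n : ℕ} {C : Fml n} {Δ : Ctx n} {D : List (Chan × Ty n)} {r : Exp n} {x z : Chan}
      {k f : ℕ} {e : Fin k → Exp n} {ys : List Chan} {Q : Proc n} {Z : Ty n} {F : PDecl k} :
      Positive S Z → S.pdecl k f = some F → (∀ i, Entails C (.isNat (e i))) →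
      Entails C (.ge r (F.pot.subst e)) →
      (∀ d ∈ D, Structural S d.2) → MatchArgs S C D ys e F.args →
      Fresh x Δ → x ≠ z →
      Forcing S C Δ (.inv [(x, F.res.subst e)]) (.sub r (F.pot.subst e)) Q z Z →
      Forcing S C ((D : Ctx n) + Δ) (.inv []) r (.spawn x k f e ys Q) z Z
  | work {n : ℕ} {C : Fml n} {Δ : Ctx n} {q r : Exp n} {P : Proc n} {x : Chan} {A : Ty n} :
      Positive S A → Entails C (.ge q r) → Forcing S C Δ (.inv []) (.sub q r) P x A →
      Forcing S C Δ (.inv []) q (.work r P) x A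
  | unsat {n : ℕ} {C : Fml n} {Δ : Ctx n} {q : Exp n} {x : Chan} {A : Ty n} :
      Positive S A → Entails C .ff → Forcing S C Δ (.inv []) q .impossible x A

end ErgoSession

open ErgoSession

/-!
Soundness and the passage between implicit and explicit programs are rule-by-rule translations
(`Forcing.sound`, `Typed.exists_explicit`, `Typed.erase`). Completeness is a focusing argument.

Call removing `?` and `▷`, or `!` and `◁`, from the front of a type *stripping* it (`Strip`). On the
left, stripping `?` and `▷` is invertible, and so is stripping `!` and `◁` on the right: an implicit
derivation of a sequent yields one of the stripped sequent, in which the stripped propositions are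
assumed and the stripped potential is available (`Typed.strip`). The delicate rules are those that
compare two types, that is forwarding, sending and spawning. For the last two, the type that the
receiver expects is structural, by polarization or by well-formedness of the declarations, so a type
equal to it cannot be stripped. For forwarding, the types at both ends can be stripped in parallel.
If the constraints are contradictory then every type equality and every entailment holds. Dually, stripping `?` and `▷` on the
right and `!` and `◁` on the left is an ordinary rule, which may be postponed as long as the
potential covers it (`Typed.unstrip`).

Completeness is then proved by induction on the program. Invertibility leads from an arbitrary
sequent to a stable one, with negative antecedents and a positive succedent
(`StableComplete.completeFor`). Reading an implicit derivation of a stable sequent upwards, only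
lazy strips can occur before the first action of the program. The forcing calculus performs those
on the channels that take part in the action, and the others are put back into the premises of the
action (`Forcing.of_stable`), to which the induction hypothesis applies. Validity is what makes all
potentials natural numbers, so that a payment can be postponed past another one.
-/

namespace ErgoSession

/-! ### Substitution and entailment -/

theorem Exp.eval_subst {n m : ℕ} (σ : Fin n → Exp m) (ρ : Fin m → ℤ) (a : Exp n) :
    (a.subst σ).eval ρ = a.eval (fun i => (σ i).eval ρ) := by
  induction a <;> simp_all [Exp.subst, Exp.eval]

theorem Exp.subst_subst {n m k : ℕ} (σ : Fin n → Exp m) (τ : Fin m → Exp k) (a : Exp n) :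
    (a.subst σ).subst τ = a.subst (fun i => (σ i).subst τ) := by
  induction a <;> simp_all [Exp.subst]

theorem liftSubst_subst {n m k : ℕ} (σ : Fin n → Exp m) (τ : Fin m → Exp k) :
    (fun i => (liftSubst σ i).subst (liftSubst τ)) = liftSubst (fun i => (σ i).subst τ) := by
  funext i
  refine Fin.cases ?_ (fun i => ?_) i
  · rfl
  · simp [liftSubst, Exp.weaken, Exp.subst_subst, Exp.subst]

theorem Fml.subst_subst {n m k : ℕ} (σ : Fin n → Exp m) (τ : Fin m → Exp k) (φ : Fml n) :
    (φ.subst σ).subst τ = φ.subst (fun i => (σ i).subst τ) := by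
  induction φ generalizing m k <;>
    simp_all [Fml.subst, Exp.subst_subst, liftSubst_subst]

theorem Ty.subst_subst {n m k : ℕ} (σ : Fin n → Exp m) (τ : Fin m → Exp k) (A : Ty n) :
    (A.subst σ).subst τ = A.subst (fun i => (σ i).subst τ) := by
  induction A generalizing m k <;>
    simp_all [Ty.subst, Exp.subst_subst, Fml.subst_subst, liftSubst_subst]

theorem eval_liftSubst {n m : ℕ} (σ : Fin n → Exp m) (i : ℤ) (ρ : Fin m → ℤ) :
    (fun j => (liftSubst σ j).eval (Fin.cases i ρ)) =
      (Fin.cases i (fun j => (σ j).eval ρ) : Fin (n + 1) → ℤ) := by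
  funext j
  refine Fin.cases ?_ (fun j => ?_) j
  · rfl
  · simp [liftSubst, Exp.weaken, Exp.eval_subst, Exp.eval]

theorem Fml.holds_subst {n m : ℕ} (σ : Fin n → Exp m) (ρ : Fin m → ℤ) (φ : Fml n) :
    (φ.subst σ).Holds ρ ↔ φ.Holds (fun i => (σ i).eval ρ) := by
  induction φ generalizing m <;>
    simp_all [Fml.subst, Fml.Holds, Exp.eval_subst, eval_liftSubst]

theorem Exp.eval_weaken {n : ℕ} (a : Exp n) (ρ : Fin (n + 1) → ℤ) :
    a.weaken.eval ρ = a.eval (fun i => ρ i.succ) :=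
  Exp.eval_subst _ _ _

theorem Fml.holds_weaken {n : ℕ} (φ : Fml n) (ρ : Fin (n + 1) → ℤ) :
    φ.weaken.Holds ρ ↔ φ.Holds (fun i => ρ i.succ) :=
  Fml.holds_subst _ _ _

theorem Fml.holds_ge {n : ℕ} (a b : Exp n) (ρ : Fin n → ℤ) :
    (Fml.ge a b).Holds ρ ↔ b.eval ρ ≤ a.eval ρ := by
  simp only [Fml.ge, Fml.Holds]; omega

theorem entails_ge {n : ℕ} {C : Fml n} {a b : Exp n} : Entails C (.ge a b) ↔
    ∀ ρ : Fin n → ℕ, C.Holds (fun i => (ρ i : ℤ)) →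
      b.eval (fun i => (ρ i : ℤ)) ≤ a.eval (fun i => (ρ i : ℤ)) := by
  simp only [Entails, Fml.holds_ge]

theorem entails_isNat {n : ℕ} {C : Fml n} {a : Exp n} : Entails C (.isNat a) ↔
    ∀ ρ : Fin n → ℕ, C.Holds (fun i => (ρ i : ℤ)) → 0 ≤ a.eval (fun i => (ρ i : ℤ)) :=
  entails_ge

theorem entails_eq {n : ℕ} {C : Fml n} {a b : Exp n} : Entails C (.eq a b) ↔
    ∀ ρ : Fin n → ℕ, C.Holds (fun i => (ρ i : ℤ)) →
      a.eval (fun i => (ρ i : ℤ)) = b.eval (fun i => (ρ i : ℤ)) :=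
  Iff.rfl

theorem Entails.refl {n : ℕ} (C : Fml n) : Entails C C := fun _ h => h

theorem Entails.trans {n : ℕ} {C C' φ : Fml n} (h : Entails C' C) (h' : Entails C φ) :
    Entails C' φ := fun ρ hρ => h' ρ (h ρ hρ)

theorem Entails.and_left {n : ℕ} (C φ : Fml n) : Entails (C.and φ) C := fun _ h => h.1

theorem Entails.and_right {n : ℕ} (C φ : Fml n) : Entails (C.and φ) φ := fun _ h => h.2

theorem Entails.and_mono {n : ℕ} {C C' : Fml n} (φ : Fml n) (h : Entails C' C) :
    Entails (C'.and φ) (C.and φ) := fun ρ hρ => ⟨h ρ hρ.1, hρ.2⟩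

theorem Entails.and_intro {n : ℕ} {C C' φ : Fml n} (h : Entails C' C) (h' : Entails C' φ) :
    Entails C' (C.and φ) := fun ρ hρ => ⟨h ρ hρ, h' ρ hρ⟩

theorem Entails.eq_trans {n : ℕ} {C : Fml n} {a b c : Exp n} (h : Entails C (.eq a b))
    (h' : Entails C (.eq b c)) : Entails C (.eq a c) := fun ρ hρ => Eq.trans (h ρ hρ) (h' ρ hρ)

theorem Entails.eq_refl {n : ℕ} (C : Fml n) (q : Exp n) : Entails C (.eq q q) := fun _ _ => rfl

/-- `σ` sends assignments satisfying `C'` to natural-number assignments satisfying `C`. -/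
def Admissible {n m : ℕ} (C : Fml n) (σ : Fin n → Exp m) (C' : Fml m) : Prop :=
  ∀ ρ : Fin m → ℕ, C'.Holds (fun i => (ρ i : ℤ)) →
    (∀ i, 0 ≤ (σ i).eval (fun i => (ρ i : ℤ))) ∧
      C.Holds (fun i => (σ i).eval (fun i => (ρ i : ℤ)))

theorem Entails.subst {n m : ℕ} {C φ : Fml n} {σ : Fin n → Exp m} {C' : Fml m}
    (h : Entails C φ) (hσ : Admissible C σ C') : Entails C' (φ.subst σ) := by
  intro ρ hρ
  obtain ⟨h0, hC⟩ := hσ ρ hρ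
  have key : (fun i => (((σ i).eval (fun i => (ρ i : ℤ))).toNat : ℤ)) =
      fun i => (σ i).eval (fun i => (ρ i : ℤ)) := funext fun i => Int.toNat_of_nonneg (h0 i)
  have := h (fun i => ((σ i).eval (fun i => (ρ i : ℤ))).toNat) (by rw [key]; exact hC)
  rw [key] at this
  exact (Fml.holds_subst _ _ _).2 this

theorem Admissible.weaken {n : ℕ} (C : Fml n) :
    Admissible C (fun i => Exp.var i.succ) C.weaken := fun ρ hρ =>
  ⟨fun i => Int.natCast_nonneg (ρ i.succ), (Fml.holds_weaken _ _).1 hρ⟩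

theorem Admissible.and {n m : ℕ} {C : Fml n} {σ : Fin n → Exp m} {C' : Fml m}
    (h : Admissible C σ C') (φ : Fml n) :
    Admissible (C.and φ) σ (C'.and (φ.subst σ)) := fun ρ hρ =>
  ⟨(h ρ hρ.1).1, (h ρ hρ.1).2, (Fml.holds_subst _ _ _).1 hρ.2⟩

theorem Admissible.lift {n m : ℕ} {C : Fml n} {σ : Fin n → Exp m} {C' : Fml m}
    (h : Admissible C σ C') : Admissible C.weaken (liftSubst σ) C'.weaken := by
  intro ρ hρ
  obtain ⟨h0, hC⟩ := h (fun i => ρ i.succ) ((Fml.holds_weaken _ _).1 hρ)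
  refine ⟨fun i => ?_, (Fml.holds_weaken _ _).2 ?_⟩
  · refine Fin.cases ?_ (fun i => ?_) i
    · exact Int.natCast_nonneg (ρ 0)
    · simpa [liftSubst, Exp.eval_weaken] using h0 i
  · simpa [liftSubst, Exp.eval_weaken] using hC

theorem Admissible.inst {n : ℕ} {C : Fml n} {e : Exp n} (he : Entails C (.isNat e)) :
    Admissible C.weaken (instSubst e) C := by
  intro ρ hρ
  refine ⟨fun i => ?_, (Fml.holds_weaken _ _).2 hρ⟩
  refine Fin.cases ?_ (fun i => ?_) i
  · exact entails_isNat.1 he ρ hρ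
  · exact Int.natCast_nonneg (ρ i)

theorem Admissible.tt {n m : ℕ} {C : Fml m} {σ : Fin n → Exp m}
    (h : ∀ i, Entails C (.isNat (σ i))) : Admissible .tt σ C := fun ρ hρ =>
  ⟨fun i => entails_isNat.1 (h i) ρ hρ, trivial⟩

theorem Entails.weaken {n : ℕ} {C φ : Fml n} (h : Entails C φ) : Entails C.weaken φ.weaken :=
  h.subst (.weaken C)

/-! ### Arithmetic of potentials -/

theorem Entails.of_eq_of_ge {n : ℕ} {C : Fml n} {q q' r : Exp n} (h : Entails C (.ge q r))
    (hq : Entails C (.eq q' q)) : Entails C (.ge q' r) :=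
  entails_ge.2 fun ρ hρ => by rw [entails_eq.1 hq ρ hρ]; exact entails_ge.1 h ρ hρ

theorem Entails.sub_congr {n : ℕ} {C : Fml n} {q q' : Exp n} (r : Exp n)
    (hq : Entails C (.eq q' q)) : Entails C (.eq (.sub q' r) (.sub q r)) :=
  fun ρ hρ => congrArg (· - _) (hq ρ hρ)

theorem Entails.add_congr {n : ℕ} {C : Fml n} {q q' : Exp n} (r : Exp n)
    (hq : Entails C (.eq q' q)) : Entails C (.eq (.add q' r) (.add q r)) :=
  fun ρ hρ => congrArg (· + _) (hq ρ hρ)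

/-- In this lemma and the next two, `q'` exceeds `q` by the potentials `c` of the antecedents and
`a` of the succedent. -/
theorem Entails.ge_of_eq_add {n : ℕ} {C : Fml n} {q q' r c a : Exp n} (h : Entails C (.ge q r))
    (hc : Entails C (.isNat c)) (ha : Entails C (.isNat a))
    (hq : Entails C (.eq q' (.add q (.add c a)))) : Entails C (.ge q' r) :=
  entails_ge.2 fun ρ hρ => by
    have h₁ := entails_ge.1 h ρ hρ
    have h₂ := entails_isNat.1 hc ρ hρ
    have h₃ := entails_isNat.1 ha ρ hρ
    have h₄ := entails_eq.1 hq ρ hρ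
    simp only [Exp.eval] at h₄
    omega

theorem Entails.sub_eq_add {n : ℕ} {C : Fml n} {q q' c a : Exp n} (r : Exp n)
    (hq : Entails C (.eq q' (.add q (.add c a)))) :
    Entails C (.eq (.sub q' r) (.add (.sub q r) (.add c a))) := fun ρ hρ => by
  have h₄ := entails_eq.1 hq ρ hρ
  simp only [Exp.eval] at h₄
  simp only [Fml.Holds, Exp.eval]
  omega

theorem Entails.add_eq_add {n : ℕ} {C : Fml n} {q q' c a : Exp n} (r : Exp n)
    (hq : Entails C (.eq q' (.add q (.add c a)))) :
    Entails C (.eq (.add q' r) (.add (.add q r) (.add c a))) := fun ρ hρ => by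
  have h₄ := entails_eq.1 hq ρ hρ
  simp only [Exp.eval] at h₄
  simp only [Fml.Holds, Exp.eval]
  omega

theorem Entails.isNat_add {n : ℕ} {C : Fml n} {q r : Exp n} (hq : Entails C (.isNat q))
    (hr : Entails C (.isNat r)) : Entails C (.isNat (.add q r)) :=
  entails_isNat.2 fun ρ hρ => add_nonneg (entails_isNat.1 hq ρ hρ) (entails_isNat.1 hr ρ hρ)

theorem Entails.isNat_sub {n : ℕ} {C : Fml n} {q r : Exp n} (h : Entails C (.ge q r)) :
    Entails C (.isNat (.sub q r)) :=
  entails_isNat.2 fun ρ hρ => sub_nonneg.2 (entails_ge.1 h ρ hρ)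

/-! ### Unfolding, polarity and validity under substitution -/

theorem Sig.unfold_subst (S : Sig) {n m : ℕ} (σ : Fin n → Exp m) (A : Ty n) :
    S.unfold (A.subst σ) = (S.unfold A).subst σ := by
  cases A <;> try rfl
  case name k V e =>
    simp only [Ty.subst, Sig.unfold]
    cases S.tdef k V <;> simp [Ty.subst, Ty.subst_subst]

theorem Ty.IsStructuralHead.subst {n m : ℕ} (σ : Fin n → Exp m) {A : Ty n}
    (h : A.IsStructuralHead) : (A.subst σ).IsStructuralHead := by
  cases A <;> simp_all [Ty.subst, Ty.IsStructuralHead]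

theorem Structural.subst {S : Sig} {n m : ℕ} (σ : Fin n → Exp m) {A : Ty n}
    (h : Structural S A) : Structural S (A.subst σ) := by
  unfold Structural
  rw [S.unfold_subst]
  exact Ty.IsStructuralHead.subst σ h

theorem Positive.subst {S : Sig} {n m : ℕ} (σ : Fin n → Exp m) {A : Ty n}
    (h : Positive S A) : Positive S (A.subst σ) := by
  induction h with
  | structural h => exact .structural (h.subst σ)
  | asserts h _ ih => exact .asserts (by rw [S.unfold_subst, h, Ty.subst]) ih
  | pays h _ ih => exact .pays (by rw [S.unfold_subst, h, Ty.subst]) ih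

theorem Negative.subst {S : Sig} {n m : ℕ} (σ : Fin n → Exp m) {A : Ty n}
    (h : Negative S A) : Negative S (A.subst σ) := by
  induction h with
  | structural h => exact .structural (h.subst σ)
  | assumes h _ ih => exact .assumes (by rw [S.unfold_subst, h, Ty.subst]) ih
  | gets h _ ih => exact .gets (by rw [S.unfold_subst, h, Ty.subst]) ih

theorem Ty.Polarized.subst {S : Sig} {n m : ℕ} (σ : Fin n → Exp m) {A : Ty n}
    (h : A.Polarized S) : (A.subst σ).Polarized S := by
  induction A generalizing m with
  | ichoice L A ih => exact fun l => ih l σ (h l)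
  | echoice L A ih => exact fun l => ih l σ (h l)
  | tensor A B ihA ihB => exact ⟨h.1.subst σ, ihA σ h.2.1, ihB σ h.2.2⟩
  | lolli A B ihA ihB => exact ⟨h.1.subst σ, ihA σ h.2.1, ihB σ h.2.2⟩
  | one => trivial
  | name k V e => exact h.imp (fun h => h.subst σ) (fun h => h.subst σ)
  | asserts φ A ih => exact ⟨h.1.subst σ, ih σ h.2⟩
  | assumes φ A ih => exact ⟨h.1.subst σ, ih σ h.2⟩
  | ex A ih => exact ih (liftSubst σ) h
  | all A ih => exact ih (liftSubst σ) h
  | pays r A ih => exact ⟨h.1.subst σ, ih σ h.2⟩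
  | gets r A ih => exact ⟨h.1.subst σ, ih σ h.2⟩

theorem Ty.Valid.mono {S : Sig} {n : ℕ} {C C' : Fml n} {A : Ty n}
    (h : A.Valid S C) (hC : Entails C' C) : A.Valid S C' := by
  induction A with
  | ichoice L A ih => exact fun l => ih l (h l) hC
  | echoice L A ih => exact fun l => ih l (h l) hC
  | tensor A B ihA ihB => exact ⟨ihA h.1 hC, ihB h.2 hC⟩
  | lolli A B ihA ihB => exact ⟨ihA h.1 hC, ihB h.2 hC⟩
  | one => trivial
  | name k V e => exact ⟨h.1, fun i => hC.trans (h.2 i)⟩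
  | asserts φ A ih => exact ih (C := C.and φ) h (hC.and_mono φ)
  | assumes φ A ih => exact ih (C := C.and φ) h (hC.and_mono φ)
  | ex A ih => exact ih (C := C.weaken) h hC.weaken
  | all A ih => exact ih (C := C.weaken) h hC.weaken
  | pays r A ih => exact ⟨hC.trans h.1, ih h.2 hC⟩
  | gets r A ih => exact ⟨hC.trans h.1, ih h.2 hC⟩

theorem Ty.Valid.subst {S : Sig} {n m : ℕ} {C : Fml n} {σ : Fin n → Exp m} {C' : Fml m}
    {A : Ty n} (h : A.Valid S C) (hσ : Admissible C σ C') : (A.subst σ).Valid S C' := by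
  induction A generalizing m with
  | ichoice L A ih => exact fun l => ih l (h l) hσ
  | echoice L A ih => exact fun l => ih l (h l) hσ
  | tensor A B ihA ihB => exact ⟨ihA h.1 hσ, ihB h.2 hσ⟩
  | lolli A B ihA ihB => exact ⟨ihA h.1 hσ, ihB h.2 hσ⟩
  | one => trivial
  | name k V e => exact ⟨h.1, fun i => (h.2 i).subst hσ⟩
  | asserts φ A ih => exact ih (C := C.and φ) h (hσ.and φ)
  | assumes φ A ih => exact ih (C := C.and φ) h (hσ.and φ)
  | ex A ih => exact ih (C := C.weaken) h hσ.lift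
  | all A ih => exact ih (C := C.weaken) h hσ.lift
  | pays r A ih => exact ⟨h.1.subst hσ, ih h.2 hσ⟩
  | gets r A ih => exact ⟨h.1.subst hσ, ih h.2 hσ⟩

theorem Ty.Polarized.unfold {S : Sig} (hS : S.WellFormed) {n : ℕ} {A : Ty n}
    (h : A.Polarized S) : (S.unfold A).Polarized S := by
  cases A <;> try exact h
  case name k V e =>
    cases hV : S.tdef k V with
    | none => simpa [Sig.unfold, hV] using h
    | some B => simpa [Sig.unfold, hV] using (hS.polarized hV).subst e

theorem Ty.Valid.unfold {S : Sig} (hS : S.WellFormed) {n : ℕ} {C : Fml n} {A : Ty n}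
    (h : A.Valid S C) : (S.unfold A).Valid S C := by
  cases A <;> try exact h
  case name k V e =>
    cases hV : S.tdef k V with
    | none => simpa [Sig.unfold, hV] using h
    | some B => simpa [Sig.unfold, hV] using (hS.valid hV).subst (.tt h.2)

/-- A polarized type is positive or negative. -/
theorem Ty.Polarized.positive_or_negative {S : Sig} {n : ℕ} {A : Ty n} (h : A.Polarized S) :
    Positive S A ∨ Negative S A := by
  cases A with
  | name k V e => exact h
  | asserts φ A => exact .inl h.1
  | assumes φ A => exact .inr h.1
  | pays r A => exact .inl h.1
  | gets r A => exact .inr h.1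
  | _ => exact .inl (.structural trivial)

/-! ### Type equality -/

theorem HeadMatch.symm {R : Ty 0 → Ty 0 → Prop} {A B : Ty 0} (h : HeadMatch R A B) :
    HeadMatch (fun a b => R b a) B A := by
  cases A <;> cases B <;> try exact False.elim h
  case ichoice => exact ⟨h.1.symm, fun l h₁ h₂ => h.2 l h₂ h₁⟩
  case echoice => exact ⟨h.1.symm, fun l h₁ h₂ => h.2 l h₂ h₁⟩
  case tensor => exact h
  case lolli => exact h
  case one => trivial
  case asserts => exact h.imp (fun h => ⟨h.2.1, h.1, h.2.2⟩) And.symm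
  case assumes => exact h.imp (fun h => ⟨h.2.1, h.1, h.2.2⟩) And.symm
  case ex => exact h
  case all => exact h
  case pays => exact ⟨fun ρ hρ => (h.1 ρ hρ).symm, h.2⟩
  case gets => exact ⟨fun ρ hρ => (h.1 ρ hρ).symm, h.2⟩

theorem TyEq.symm {S : Sig} {n : ℕ} {C : Fml n} {A B : Ty n} (h : TyEq S C A B) :
    TyEq S C B A := by
  intro ρ hρ
  obtain ⟨R, hR, hAB⟩ := h ρ hρ
  exact ⟨fun a b => R b a, fun a b hab => (hR b a hab).symm, hAB⟩

theorem TyEq.mono {S : Sig} {n : ℕ} {C C' : Fml n} {A B : Ty n} (h : TyEq S C A B)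
    (hC : Entails C' C) : TyEq S C' A B := fun ρ hρ => h ρ (hC ρ hρ)

theorem TyEq.of_unsat {S : Sig} {n : ℕ} {C : Fml n} (A B : Ty n) (hC : Entails C .ff) :
    TyEq S C A B := fun ρ hρ => (hC ρ hρ).elim

theorem TyEq.headMatch {S : Sig} {n : ℕ} {C : Fml n} {A B : Ty n} (h : TyEq S C A B)
    {ρ : Fin n → ℕ} (hρ : C.Holds (fun i => (ρ i : ℤ))) :
    HeadMatch (ClosedTyEq S) ((S.unfold A).subst (fun i => .const (ρ i)))
      ((S.unfold B).subst (fun i => .const (ρ i))) := by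
  obtain ⟨R, hR, hAB⟩ := h ρ hρ
  have hle : ∀ {a b}, R a b → ClosedTyEq S a b := fun hab => ⟨R, hR, hab⟩
  have := hR _ _ hAB
  rw [S.unfold_subst, S.unfold_subst] at this
  revert this
  generalize (S.unfold A).subst (fun i => .const (ρ i)) = A'
  generalize (S.unfold B).subst (fun i => .const (ρ i)) = B'
  intro h
  cases A' <;> cases B' <;> try exact False.elim h
  case ichoice => exact ⟨h.1, fun l h₁ h₂ => hle (h.2 l h₁ h₂)⟩
  case echoice => exact ⟨h.1, fun l h₁ h₂ => hle (h.2 l h₁ h₂)⟩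
  case tensor => exact ⟨hle h.1, hle h.2⟩
  case lolli => exact ⟨hle h.1, hle h.2⟩
  case one => trivial
  case asserts => exact h.imp (fun h => ⟨h.1, h.2.1, hle h.2.2⟩) id
  case assumes => exact h.imp (fun h => ⟨h.1, h.2.1, hle h.2.2⟩) id
  case ex => exact fun i => hle (h i)
  case all => exact fun i => hle (h i)
  case pays => exact ⟨h.1, hle h.2⟩
  case gets => exact ⟨h.1, hle h.2⟩

theorem entails_closed {n : ℕ} (φ : Fml n) (ρ : Fin n → ℕ) :
    Entails .tt (φ.subst (fun i => Exp.const (n := 0) (ρ i))) ↔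
      φ.Holds (fun i => (ρ i : ℤ)) := by
  simp only [Entails, Fml.holds_subst, Exp.eval]
  exact ⟨fun h => h (fun i => i.elim0) trivial, fun h _ _ => h⟩

/-- `C` is satisfied by some natural-number assignment. -/
def Satisfiable {n : ℕ} (C : Fml n) : Prop := ∃ ρ : Fin n → ℕ, C.Holds (fun i => (ρ i : ℤ))

theorem entails_ff_or_satisfiable {n : ℕ} (C : Fml n) : Entails C .ff ∨ Satisfiable C := by
  by_cases h : Satisfiable C
  · exact .inr h
  · exact .inl fun ρ hρ => h ⟨ρ, hρ⟩

theorem TyEq.structural {S : Sig} {n : ℕ} {C : Fml n} {A B : Ty n} (h : TyEq S C A B)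
    (hC : Satisfiable C) (hA : Structural S A) : Structural S B := by
  obtain ⟨ρ, hρ⟩ := hC
  have h := h.headMatch hρ
  unfold Structural at *
  generalize S.unfold A = A' at *
  generalize S.unfold B = B' at *
  cases A' <;> cases B' <;> trivial

/-- Equal types assert equivalent propositions. The bodies are only known to be equal where the
proposition holds, whence the hypothesis `hφ`; satisfiability of `C` pins down the head of `B`. -/
theorem TyEq.unfold_asserts {S : Sig} {n : ℕ} {C φ : Fml n} {A A' B : Ty n}
    (h : TyEq S C A B) (hC : Satisfiable C) (hA : S.unfold A = .asserts φ A')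
    (hφ : Entails C φ) :
    ∃ ψ B', S.unfold B = .asserts ψ B' ∧ Entails C ψ ∧ TyEq S C A' B' := by
  have key := fun ρ hρ => h.headMatch (ρ := ρ) hρ
  rw [hA] at key
  obtain ⟨ρ₀, hρ₀⟩ := hC
  have h₀ := key ρ₀ hρ₀
  revert h₀ key
  generalize S.unfold B = B'
  cases B' <;> intro key h₀ <;> try exact False.elim h₀
  case asserts ψ B' =>
    have key' : ∀ ρ : Fin n → ℕ, C.Holds (fun i => (ρ i : ℤ)) →
        ψ.Holds (fun i => (ρ i : ℤ)) ∧ ClosedTyEq S (A'.subst (fun i => .const (ρ i)))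
          (B'.subst (fun i => .const (ρ i))) := by
      intro ρ hρ
      rcases key ρ hρ with h | h
      · exact ⟨(entails_closed ψ ρ).1 h.2.1, h.2.2⟩
      · exact ((entails_closed φ.neg ρ).1 h.1 (hφ ρ hρ)).elim
    exact ⟨ψ, B', rfl, fun ρ hρ => (key' ρ hρ).1, fun ρ hρ => (key' ρ hρ).2⟩

theorem TyEq.unfold_assumes {S : Sig} {n : ℕ} {C φ : Fml n} {A A' B : Ty n}
    (h : TyEq S C A B) (hC : Satisfiable C) (hA : S.unfold A = .assumes φ A')
    (hφ : Entails C φ) :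
    ∃ ψ B', S.unfold B = .assumes ψ B' ∧ Entails C ψ ∧ TyEq S C A' B' := by
  have key := fun ρ hρ => h.headMatch (ρ := ρ) hρ
  rw [hA] at key
  obtain ⟨ρ₀, hρ₀⟩ := hC
  have h₀ := key ρ₀ hρ₀
  revert h₀ key
  generalize S.unfold B = B'
  cases B' <;> intro key h₀ <;> try exact False.elim h₀
  case assumes ψ B' =>
    have key' : ∀ ρ : Fin n → ℕ, C.Holds (fun i => (ρ i : ℤ)) →
        ψ.Holds (fun i => (ρ i : ℤ)) ∧ ClosedTyEq S (A'.subst (fun i => .const (ρ i)))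
          (B'.subst (fun i => .const (ρ i))) := by
      intro ρ hρ
      rcases key ρ hρ with h | h
      · exact ⟨(entails_closed ψ ρ).1 h.2.1, h.2.2⟩
      · exact ((entails_closed φ.neg ρ).1 h.1 (hφ ρ hρ)).elim
    exact ⟨ψ, B', rfl, fun ρ hρ => (key' ρ hρ).1, fun ρ hρ => (key' ρ hρ).2⟩

theorem TyEq.unfold_pays {S : Sig} {n : ℕ} {C : Fml n} {r : Exp n} {A A' B : Ty n}
    (h : TyEq S C A B) (hC : Satisfiable C) (hA : S.unfold A = .pays r A') :
    ∃ s B', S.unfold B = .pays s B' ∧ Entails C (.eq r s) ∧ TyEq S C A' B' := by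
  have key := fun ρ hρ => h.headMatch (ρ := ρ) hρ
  rw [hA] at key
  obtain ⟨ρ₀, hρ₀⟩ := hC
  have h₀ := key ρ₀ hρ₀
  revert h₀ key
  generalize S.unfold B = B'
  cases B' <;> intro key h₀ <;> try exact False.elim h₀
  case pays s B' =>
    exact ⟨s, B', rfl, fun ρ hρ => (entails_closed (.eq r s) ρ).1 (key ρ hρ).1,
      fun ρ hρ => (key ρ hρ).2⟩

theorem TyEq.unfold_gets {S : Sig} {n : ℕ} {C : Fml n} {r : Exp n} {A A' B : Ty n}
    (h : TyEq S C A B) (hC : Satisfiable C) (hA : S.unfold A = .gets r A') :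
    ∃ s B', S.unfold B = .gets s B' ∧ Entails C (.eq r s) ∧ TyEq S C A' B' := by
  have key := fun ρ hρ => h.headMatch (ρ := ρ) hρ
  rw [hA] at key
  obtain ⟨ρ₀, hρ₀⟩ := hC
  have h₀ := key ρ₀ hρ₀
  revert h₀ key
  generalize S.unfold B = B'
  cases B' <;> intro key h₀ <;> try exact False.elim h₀
  case gets s B' =>
    exact ⟨s, B', rfl, fun ρ hρ => (entails_closed (.eq r s) ρ).1 (key ρ hρ).1,
      fun ρ hρ => (key ρ hρ).2⟩

/-! ### Stripping the proof and potential constructors off a type -/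

/-- The two families of proof and potential constructors: `?`, `▷` and `!`, `◁`. -/
inductive Polarity
  | pos
  | neg

/-- `Strip S C p A c B`: under `C`, the type `B` arises from `A` by removing leading constructors
of polarity `p` (up to unfolding) whose propositions are provable and whose potentials are natural
numbers that add up to `c`. Any expression equal to the sum under `C` may serve as `c`. -/
inductive Strip (S : Sig) {n : ℕ} (C : Fml n) : Polarity → Ty n → Exp n → Ty n → Prop
  | refl {p : Polarity} {A : Ty n} {c : Exp n} : Entails C (.eq c (.const 0)) → Strip S C p A c A
  | asserts {A A' B : Ty n} {φ : Fml n} {c : Exp n} : S.unfold A = .asserts φ A' →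
      Entails C φ → Strip S C .pos A' c B → Strip S C .pos A c B
  | pays {A A' B : Ty n} {r c c' : Exp n} : S.unfold A = .pays r A' → Entails C (.isNat r) →
      Entails C (.eq c (.add r c')) → Strip S C .pos A' c' B → Strip S C .pos A c B
  | assumes {A A' B : Ty n} {φ : Fml n} {c : Exp n} : S.unfold A = .assumes φ A' →
      Entails C φ → Strip S C .neg A' c B → Strip S C .neg A c B
  | gets {A A' B : Ty n} {r c c' : Exp n} : S.unfold A = .gets r A' → Entails C (.isNat r) →
      Entails C (.eq c (.add r c')) → Strip S C .neg A' c' B → Strip S C .neg A c B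

namespace Strip

variable {S : Sig} {n : ℕ} {C : Fml n} {p : Polarity} {A B : Ty n} {c : Exp n}

theorem zero (A : Ty n) : Strip S C p A (.const 0) A := .refl (.eq_refl C _)

theorem isNat (h : Strip S C p A c B) : Entails C (.isNat c) := by
  rw [entails_isNat]
  induction h with
  | refl hc => exact fun ρ hρ => le_of_eq (hc ρ hρ).symm
  | asserts _ _ _ ih => exact ih
  | assumes _ _ _ ih => exact ih
  | pays _ hr hc _ ih =>
    intro ρ hρ
    have h₁ := entails_isNat.1 hr ρ hρ
    have h₂ := entails_eq.1 hc ρ hρ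
    have h₃ := ih ρ hρ
    simp only [Exp.eval] at h₂
    omega
  | gets _ hr hc _ ih =>
    intro ρ hρ
    have h₁ := entails_isNat.1 hr ρ hρ
    have h₂ := entails_eq.1 hc ρ hρ
    have h₃ := ih ρ hρ
    simp only [Exp.eval] at h₂
    omega

theorem congr (h : Strip S C p A c B) {c' : Exp n} (hc : Entails C (.eq c' c)) :
    Strip S C p A c' B := by
  induction h generalizing c' with
  | refl h => exact .refl (hc.eq_trans h)
  | asserts hA hφ _ ih => exact .asserts hA hφ (ih hc)
  | assumes hA hφ _ ih => exact .assumes hA hφ (ih hc)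
  | pays hA hr h₁ h₂ _ => exact .pays hA hr (hc.eq_trans h₁) h₂
  | gets hA hr h₁ h₂ _ => exact .gets hA hr (hc.eq_trans h₁) h₂

theorem trans {A' : Ty n} {c₁ c₂ : Exp n} (h : Strip S C p A c₁ A') (h' : Strip S C p A' c₂ B)
    (hc : Entails C (.eq c (.add c₁ c₂))) : Strip S C p A c B := by
  induction h generalizing c with
  | refl h =>
    refine h'.congr fun ρ hρ => ?_
    have h₁ := entails_eq.1 hc ρ hρ
    have h₂ := entails_eq.1 h ρ hρ
    simp only [Exp.eval] at h₁ h₂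
    simp only [Fml.Holds]
    omega
  | asserts hA hφ _ ih => exact .asserts hA hφ (ih h' hc)
  | assumes hA hφ _ ih => exact .assumes hA hφ (ih h' hc)
  | pays hA hr h₁ _ ih =>
    refine .pays hA hr (fun ρ hρ => ?_) (ih h' (.eq_refl C _))
    have h₁ := entails_eq.1 h₁ ρ hρ
    have h₂ := entails_eq.1 hc ρ hρ
    simp only [Exp.eval] at h₁ h₂
    simp only [Fml.Holds, Exp.eval]
    omega
  | gets hA hr h₁ _ ih =>
    refine .gets hA hr (fun ρ hρ => ?_) (ih h' (.eq_refl C _))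
    have h₁ := entails_eq.1 h₁ ρ hρ
    have h₂ := entails_eq.1 hc ρ hρ
    simp only [Exp.eval] at h₁ h₂
    simp only [Fml.Holds, Exp.eval]
    omega

theorem mono (h : Strip S C p A c B) {C' : Fml n} (hC : Entails C' C) : Strip S C' p A c B := by
  induction h with
  | refl h => exact .refl (hC.trans h)
  | asserts hA hφ _ ih => exact .asserts hA (hC.trans hφ) ih
  | assumes hA hφ _ ih => exact .assumes hA (hC.trans hφ) ih
  | pays hA hr h₁ _ ih => exact .pays hA (hC.trans hr) (hC.trans h₁) ih
  | gets hA hr h₁ _ ih => exact .gets hA (hC.trans hr) (hC.trans h₁) ih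

theorem weaken (h : Strip S C p A c B) : Strip S C.weaken p A.weaken c.weaken B.weaken := by
  have hu : ∀ D : Ty n, S.unfold D.weaken = (S.unfold D).weaken := fun D => S.unfold_subst _ D
  induction h with
  | refl h => exact .refl h.weaken
  | asserts hA hφ _ ih => exact .asserts (by rw [hu, hA]; rfl) hφ.weaken ih
  | assumes hA hφ _ ih => exact .assumes (by rw [hu, hA]; rfl) hφ.weaken ih
  | pays hA hr h₁ _ ih => exact .pays (by rw [hu, hA]; rfl) hr.weaken h₁.weaken ih
  | gets hA hr h₁ _ ih => exact .gets (by rw [hu, hA]; rfl) hr.weaken h₁.weaken ih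

/-- Nothing can be stripped off a type whose head is structural or of the other polarity. -/
theorem eq_of_unfold (h : Strip S C p A c B)
    (hA : match p with
      | .pos => (∀ φ A', S.unfold A ≠ .asserts φ A') ∧ ∀ r A', S.unfold A ≠ .pays r A'
      | .neg => (∀ φ A', S.unfold A ≠ .assumes φ A') ∧ ∀ r A', S.unfold A ≠ .gets r A') :
    B = A ∧ Entails C (.eq c (.const 0)) := by
  cases h with
  | refl h => exact ⟨rfl, h⟩
  | asserts h => exact (hA.1 _ _ h).elim
  | assumes h => exact (hA.1 _ _ h).elim
  | pays h => exact (hA.2 _ _ h).elim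
  | gets h => exact (hA.2 _ _ h).elim

theorem eq_of_structural (h : Strip S C p A c B) (hA : Structural S A) :
    B = A ∧ Entails C (.eq c (.const 0)) := by
  apply h.eq_of_unfold
  unfold Structural at hA
  cases p <;> constructor <;> intro _ _ h <;> rw [h] at hA <;> exact hA

/-- Equal types can be stripped in parallel. -/
theorem of_tyEq (h : Strip S C p A c B) (hC : Satisfiable C) {A' : Ty n} (hA : TyEq S C A A') :
    ∃ B', Strip S C p A' c B' ∧ TyEq S C B B' := by
  induction h generalizing A' with
  | refl h => exact ⟨A', .refl h, hA⟩
  | asserts hu hφ _ ih =>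
    obtain ⟨ψ, A'', hu', hψ, heq⟩ := hA.unfold_asserts hC hu hφ
    obtain ⟨B', h₁, h₂⟩ := ih heq
    exact ⟨B', .asserts hu' hψ h₁, h₂⟩
  | assumes hu hφ _ ih =>
    obtain ⟨ψ, A'', hu', hψ, heq⟩ := hA.unfold_assumes hC hu hφ
    obtain ⟨B', h₁, h₂⟩ := ih heq
    exact ⟨B', .assumes hu' hψ h₁, h₂⟩
  | pays hu hr hc _ ih =>
    obtain ⟨s, A'', hu', hs, heq⟩ := hA.unfold_pays hC hu
    obtain ⟨B', h₁, h₂⟩ := ih heq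
    refine ⟨B', .pays hu' (entails_isNat.2 fun ρ hρ => ?_) (fun ρ hρ => ?_) h₁, h₂⟩
    · rw [← entails_eq.1 hs ρ hρ]; exact entails_isNat.1 hr ρ hρ
    · have h₁ := entails_eq.1 hc ρ hρ
      have h₂ := entails_eq.1 hs ρ hρ
      simp only [Exp.eval] at h₁
      simp only [Fml.Holds, Exp.eval]
      omega
  | gets hu hr hc _ ih =>
    obtain ⟨s, A'', hu', hs, heq⟩ := hA.unfold_gets hC hu
    obtain ⟨B', h₁, h₂⟩ := ih heq
    refine ⟨B', .gets hu' (entails_isNat.2 fun ρ hρ => ?_) (fun ρ hρ => ?_) h₁, h₂⟩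
    · rw [← entails_eq.1 hs ρ hρ]; exact entails_isNat.1 hr ρ hρ
    · have h₁ := entails_eq.1 hc ρ hρ
      have h₂ := entails_eq.1 hs ρ hρ
      simp only [Exp.eval] at h₁
      simp only [Fml.Holds, Exp.eval]
      omega

theorem positive (h : Strip S C .pos A c B) (hA : Positive S A) : Positive S B := by
  generalize hp : Polarity.pos = p at h
  induction h with
  | refl => exact hA
  | asserts hu _ _ ih =>
    refine ih ?_ hp
    cases hA with
    | structural h => rw [Structural, hu] at h; exact h.elim
    | asserts hu' h => rw [hu] at hu'; cases hu'; exact h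
    | pays hu' h => rw [hu] at hu'; cases hu'
  | pays hu _ _ _ ih =>
    refine ih ?_ hp
    cases hA with
    | structural h => rw [Structural, hu] at h; exact h.elim
    | asserts hu' h => rw [hu] at hu'; cases hu'
    | pays hu' h => rw [hu] at hu'; cases hu'; exact h
  | assumes => cases hp
  | gets => cases hp

theorem negative (h : Strip S C .neg A c B) (hA : Negative S A) : Negative S B := by
  generalize hp : Polarity.neg = p at h
  induction h with
  | refl => exact hA
  | assumes hu _ _ ih =>
    refine ih ?_ hp
    cases hA with
    | structural h => rw [Structural, hu] at h; exact h.elim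
    | assumes hu' h => rw [hu] at hu'; cases hu'; exact h
    | gets hu' h => rw [hu] at hu'; cases hu'
  | gets hu _ _ _ ih =>
    refine ih ?_ hp
    cases hA with
    | structural h => rw [Structural, hu] at h; exact h.elim
    | assumes hu' h => rw [hu] at hu'; cases hu'
    | gets hu' h => rw [hu] at hu'; cases hu'; exact h
  | asserts => cases hp
  | pays => cases hp

end Strip

/-- `CtxStrip S C p Δ c Δ'`: the context `Δ'` arises from `Δ` by stripping each type, at the total
potential `c`. -/
inductive CtxStrip (S : Sig) {n : ℕ} (C : Fml n) (p : Polarity) : Ctx n → Exp n → Ctx n → Prop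
  | nil {c : Exp n} : Entails C (.eq c (.const 0)) → CtxStrip S C p 0 c 0
  | cons {Δ Δ' : Ctx n} {x : Chan} {A A' : Ty n} {a b c : Exp n} :
      Strip S C p A a A' → CtxStrip S C p Δ b Δ' → Entails C (.eq c (.add a b)) →
      CtxStrip S C p ((x, A) ::ₘ Δ) c ((x, A') ::ₘ Δ')

namespace CtxStrip

variable {S : Sig} {n : ℕ} {C : Fml n} {p : Polarity} {Δ Δ' : Ctx n} {c : Exp n}

theorem congr (h : CtxStrip S C p Δ c Δ') {c' : Exp n} (hc : Entails C (.eq c' c)) :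
    CtxStrip S C p Δ c' Δ' := by
  cases h with
  | nil h => exact .nil (hc.eq_trans h)
  | cons h₁ h₂ h₃ => exact .cons h₁ h₂ (hc.eq_trans h₃)

theorem isNat (h : CtxStrip S C p Δ c Δ') : Entails C (.isNat c) := by
  rw [entails_isNat]
  induction h with
  | nil hc => exact fun ρ hρ => le_of_eq (hc ρ hρ).symm
  | cons h₁ _ hc ih =>
    intro ρ hρ
    have h₁ := entails_isNat.1 h₁.isNat ρ hρ
    have h₂ := entails_eq.1 hc ρ hρ
    have h₃ := ih ρ hρ
    simp only [Exp.eval] at h₂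
    omega

theorem refl (Δ : Ctx n) : CtxStrip S C p Δ (.const 0) Δ := by
  induction Δ using Multiset.induction with
  | empty => exact .nil (.eq_refl C _)
  | cons a Δ ih => exact .cons (.zero a.2) ih fun _ _ => rfl

theorem cons_refl (h : CtxStrip S C p Δ c Δ') (d : Chan × Ty n) :
    CtxStrip S C p (d ::ₘ Δ) c (d ::ₘ Δ') :=
  .cons (.zero d.2) h fun _ _ => (zero_add (c.eval _)).symm

theorem mono (h : CtxStrip S C p Δ c Δ') {C' : Fml n} (hC : Entails C' C) :
    CtxStrip S C' p Δ c Δ' := by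
  induction h with
  | nil h => exact .nil (hC.trans h)
  | cons h₁ _ hc ih => exact .cons (h₁.mono hC) ih (hC.trans hc)

theorem weaken (h : CtxStrip S C p Δ c Δ') :
    CtxStrip S C.weaken p Δ.weaken c.weaken Δ'.weaken := by
  induction h with
  | nil h => exact .nil h.weaken
  | cons h₁ _ hc ih =>
    simp only [Ctx.weaken, Multiset.map_cons] at ih ⊢
    exact .cons h₁.weaken ih hc.weaken

theorem fresh_iff (h : CtxStrip S C p Δ c Δ') (y : Chan) : Fresh y Δ ↔ Fresh y Δ' := by
  induction h with
  | nil => exact Iff.rfl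
  | cons _ _ _ ih => simpa [Fresh] using fun _ => ih

theorem of_cons_left {x : Chan} {A : Ty n} (h : CtxStrip S C p ((x, A) ::ₘ Δ) c Δ') :
    ∃ A' Δ₁ a b, Δ' = (x, A') ::ₘ Δ₁ ∧ Strip S C p A a A' ∧ CtxStrip S C p Δ b Δ₁ ∧
      Entails C (.eq c (.add a b)) := by
  generalize hΓ : (x, A) ::ₘ Δ = Γ at h
  induction h generalizing Δ with
  | nil => exact (Multiset.cons_ne_zero hΓ).elim
  | @cons Γ Γ' y B B' a b c h₁ h₂ hc ih =>
    rcases Multiset.cons_eq_cons.1 hΓ with ⟨h, rfl⟩ | ⟨-, Θ, rfl, rfl⟩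
    · cases h
      exact ⟨B', Γ', a, b, rfl, h₁, h₂, hc⟩
    · obtain ⟨A', Δ₁, a', b', rfl, h₃, h₄, hb⟩ := ih rfl
      refine ⟨A', (y, B') ::ₘ Δ₁, a', .add a b', Multiset.cons_swap _ _ _, h₃,
        .cons h₁ h₄ (.eq_refl C _), fun ρ hρ => ?_⟩
      have h₁ := entails_eq.1 hc ρ hρ
      have h₂ := entails_eq.1 hb ρ hρ
      simp only [Exp.eval] at h₁ h₂
      simp only [Fml.Holds, Exp.eval]
      omega

theorem of_cons_right {x : Chan} {A' : Ty n} (h : CtxStrip S C p Δ c ((x, A') ::ₘ Δ')) :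
    ∃ A Δ₁ a b, Δ = (x, A) ::ₘ Δ₁ ∧ Strip S C p A a A' ∧ CtxStrip S C p Δ₁ b Δ' ∧
      Entails C (.eq c (.add a b)) := by
  generalize hΓ : (x, A') ::ₘ Δ' = Γ at h
  induction h generalizing Δ' with
  | nil => exact (Multiset.cons_ne_zero hΓ).elim
  | @cons Γ' Γ y B' B a b c h₁ h₂ hc ih =>
    rcases Multiset.cons_eq_cons.1 hΓ with ⟨h, rfl⟩ | ⟨-, Θ, rfl, rfl⟩
    · cases h
      exact ⟨B', Γ', a, b, rfl, h₁, h₂, hc⟩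
    · obtain ⟨A', Δ₁, a', b', rfl, h₃, h₄, hb⟩ := ih rfl
      refine ⟨A', (y, B') ::ₘ Δ₁, a', .add a b', Multiset.cons_swap _ _ _, h₃,
        .cons h₁ h₄ (.eq_refl C _), fun ρ hρ => ?_⟩
      have h₁ := entails_eq.1 hc ρ hρ
      have h₂ := entails_eq.1 hb ρ hρ
      simp only [Exp.eval] at h₁ h₂
      simp only [Fml.Holds, Exp.eval]
      omega

theorem eq_zero_left (h : CtxStrip S C p 0 c Δ') : Δ' = 0 ∧ Entails C (.eq c (.const 0)) := by
  generalize hΓ : (0 : Ctx n) = Γ at h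
  cases h with
  | nil h => exact ⟨rfl, h⟩
  | cons => exact (Multiset.cons_ne_zero hΓ.symm).elim

theorem eq_zero_right (h : CtxStrip S C p Δ c 0) : Δ = 0 ∧ Entails C (.eq c (.const 0)) := by
  generalize hΓ : (0 : Ctx n) = Γ at h
  cases h with
  | nil h => exact ⟨rfl, h⟩
  | cons => exact (Multiset.cons_ne_zero hΓ.symm).elim

end CtxStrip

/-! ### Implicit and explicit typing -/

theorem MatchArgs.mono {S : Sig} {n k : ℕ} {C C' : Fml n} {D : List (Chan × Ty n)}
    {ys : List Chan} {e : Fin k → Exp n} {Bs : List (Ty k)} (h : MatchArgs S C D ys e Bs)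
    (hC : Entails C' C) : MatchArgs S C' D ys e Bs :=
  ⟨h.1, h.2.imp fun _ _ h => h.mono hC⟩

/-- Typing is stable under strengthening the constraints and replacing the potential by one that
is provably equal. -/
theorem Typed.mono {S : Sig} {m : Mode} {n : ℕ} {C : Fml n} {Δ : Ctx n} {q : Exp n} {P : Proc n}
    {x : Chan} {A : Ty n} (h : Typed S m C Δ q P x A) {C' : Fml n} {q' : Exp n}
    (hC : Entails C' C) (hq : Entails C' (.eq q' q)) : Typed S m C' Δ q' P x A := by
  induction h with
  | id h₁ h₂ => exact .id (hq.eq_trans (hC.trans h₁)) (h₂.mono hC)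
  | spawn h₁ h₂ h₃ h₄ h₅ h₆ _ ih =>
    exact .spawn h₁ (fun i => hC.trans (h₂ i)) ((hC.trans h₃).of_eq_of_ge hq) (h₄.mono hC) h₅ h₆
      (ih hC (hq.sub_congr _))
  | ichoiceR l h _ ih => exact .ichoiceR l h (ih hC hq)
  | ichoiceL h _ ih => exact .ichoiceL h fun l => ih l hC hq
  | echoiceR h _ ih => exact .echoiceR h fun l => ih l hC hq
  | echoiceL l h _ ih => exact .echoiceL l h (ih hC hq)
  | tensorR h₁ h₂ _ ih => exact .tensorR h₁ (h₂.mono hC) (ih hC hq)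
  | tensorL h₁ h₂ h₃ h₄ _ ih => exact .tensorL h₁ h₂ h₃ h₄ (ih hC hq)
  | lolliR h₁ h₂ h₃ _ ih => exact .lolliR h₁ h₂ h₃ (ih hC hq)
  | lolliL h₁ h₂ _ ih => exact .lolliL h₁ (h₂.mono hC) (ih hC hq)
  | oneR h₁ h₂ => exact .oneR h₁ (hq.eq_trans (hC.trans h₂))
  | oneL h _ ih => exact .oneL h (ih hC hq)
  | exR h₁ h₂ _ ih => exact .exR h₁ (hC.trans h₂) (ih hC hq)
  | exL h _ ih => exact .exL h (ih hC.weaken hq.weaken)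
  | allR h _ ih => exact .allR h (ih hC.weaken hq.weaken)
  | allL h₁ h₂ _ ih => exact .allL h₁ (hC.trans h₂) (ih hC hq)
  | work h _ ih => exact .work ((hC.trans h).of_eq_of_ge hq) (ih hC (hq.sub_congr _))
  | unsat h => exact .unsat (hC.trans h)
  | assertsR hm h₁ h₂ _ ih => exact .assertsR hm h₁ (hC.trans h₂) (ih hC hq)
  | assertsL hm h _ ih =>
    exact .assertsL hm h (ih (hC.and_mono _) ((Entails.and_left _ _).trans hq))
  | assumesR hm h _ ih =>
    exact .assumesR hm h (ih (hC.and_mono _) ((Entails.and_left _ _).trans hq))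
  | assumesL hm h₁ h₂ _ ih => exact .assumesL hm h₁ (hC.trans h₂) (ih hC hq)
  | paysR hm h₁ h₂ _ ih =>
    exact .paysR hm h₁ ((hC.trans h₂).of_eq_of_ge hq) (ih hC (hq.sub_congr _))
  | paysL hm h _ ih => exact .paysL hm h (ih hC (hq.add_congr _))
  | getsR hm h _ ih => exact .getsR hm h (ih hC (hq.add_congr _))
  | getsL hm h₁ h₂ _ ih =>
    exact .getsL hm h₁ ((hC.trans h₂).of_eq_of_ge hq) (ih hC (hq.sub_congr _))
  | assertsR' hm h₁ h₂ h₃ _ ih =>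
    exact .assertsR' hm h₁ (hC.trans h₂) (hC.trans h₃) (ih hC hq)
  | assertsL' hm h₁ h₂ _ ih =>
    exact .assertsL' hm h₁ ((hC.and_mono _).trans h₂)
      (ih (hC.and_mono _) ((Entails.and_left _ _).trans hq))
  | assumesR' hm h₁ h₂ _ ih =>
    exact .assumesR' hm h₁ ((hC.and_mono _).trans h₂)
      (ih (hC.and_mono _) ((Entails.and_left _ _).trans hq))
  | assumesL' hm h₁ h₂ h₃ _ ih =>
    exact .assumesL' hm h₁ (hC.trans h₂) (hC.trans h₃) (ih hC hq)
  | paysR' hm h₁ h₂ h₃ _ ih =>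
    exact .paysR' hm h₁ ((hC.trans h₂).of_eq_of_ge hq) (hC.trans h₃) (ih hC (hq.sub_congr _))
  | paysL' hm h₁ h₂ _ ih => exact .paysL' hm h₁ (hC.trans h₂) (ih hC (hq.add_congr _))
  | getsR' hm h₁ h₂ _ ih => exact .getsR' hm h₁ (hC.trans h₂) (ih hC (hq.add_congr _))
  | getsL' hm h₁ h₂ h₃ _ ih =>
    exact .getsL' hm h₁ ((hC.trans h₂).of_eq_of_ge hq) (hC.trans h₃) (ih hC (hq.sub_congr _))

/-- Erasing the proof and potential constructs of an explicit program gives an implicit one. -/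
theorem Typed.erase {S : Sig} {n : ℕ} {C : Fml n} {Δ : Ctx n} {q : Exp n} {P : Proc n}
    {x : Chan} {A : Ty n} (h : ExplicitTyped S C Δ q P x A) :
    ImplicitTyped S C Δ q P.erase x A := by
  induction h with
  | id h₁ h₂ => exact .id h₁ h₂
  | spawn h₁ h₂ h₃ h₄ h₅ h₆ _ ih => exact .spawn h₁ h₂ h₃ h₄ h₅ h₆ ih
  | ichoiceR l h _ ih => exact .ichoiceR l h ih
  | ichoiceL h _ ih => exact .ichoiceL h ih
  | echoiceR h _ ih => exact .echoiceR h ih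
  | echoiceL l h _ ih => exact .echoiceL l h ih
  | tensorR h₁ h₂ _ ih => exact .tensorR h₁ h₂ ih
  | tensorL h₁ h₂ h₃ h₄ _ ih => exact .tensorL h₁ h₂ h₃ h₄ ih
  | lolliR h₁ h₂ h₃ _ ih => exact .lolliR h₁ h₂ h₃ ih
  | lolliL h₁ h₂ _ ih => exact .lolliL h₁ h₂ ih
  | oneR h₁ h₂ => exact .oneR h₁ h₂
  | oneL h _ ih => exact .oneL h ih
  | exR h₁ h₂ _ ih => exact .exR h₁ h₂ ih
  | exL h _ ih => exact .exL h ih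
  | allR h _ ih => exact .allR h ih
  | allL h₁ h₂ _ ih => exact .allL h₁ h₂ ih
  | work h _ ih => exact .work h ih
  | unsat h => exact .unsat h
  | assertsR' _ h₁ _ h₃ _ ih => exact .assertsR rfl h₁ h₃ ih
  | assertsL' _ h₁ h₂ _ ih =>
    exact .assertsL rfl h₁ (ih.mono (.and_intro (.and_left _ _) h₂) (.eq_refl _ _))
  | assumesR' _ h₁ h₂ _ ih =>
    exact .assumesR rfl h₁ (ih.mono (.and_intro (.and_left _ _) h₂) (.eq_refl _ _))
  | assumesL' _ h₁ _ h₃ _ ih => exact .assumesL rfl h₁ h₃ ih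
  | @paysR' n C Δ q r r' P x A A' _ h₁ h₂ h₃ _ ih =>
    refine .paysR rfl h₁ ?_ (ih.mono (.refl C) fun ρ hρ => ?_)
    · exact entails_ge.2 fun ρ hρ => by
        rw [← entails_eq.1 h₃ ρ hρ]; exact entails_ge.1 h₂ ρ hρ
    · exact congrArg (_ - ·) (h₃ ρ hρ).symm
  | @paysL' n C Δ q r r' Q x z A A' Z _ h₁ h₂ _ ih =>
    exact .paysL rfl h₁ (ih.mono (.refl C) fun ρ hρ => congrArg (_ + ·) (h₂ ρ hρ).symm)
  | @getsR' n C Δ q r r' P x A A' _ h₁ h₂ _ ih =>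
    exact .getsR rfl h₁ (ih.mono (.refl C) fun ρ hρ => congrArg (_ + ·) (h₂ ρ hρ).symm)
  | @getsL' n C Δ q r r' Q x z A A' Z _ h₁ h₂ h₃ _ ih =>
    refine .getsL rfl h₁ ?_ (ih.mono (.refl C) fun ρ hρ => ?_)
    · exact entails_ge.2 fun ρ hρ => by
        rw [← entails_eq.1 h₃ ρ hρ]; exact entails_ge.1 h₂ ρ hρ
    · exact congrArg (_ - ·) (h₃ ρ hρ).symm
  | _ hm => cases hm

/-- An implicit derivation can be recorded in an explicit program. -/
theorem Typed.exists_explicit {S : Sig} {n : ℕ} {C : Fml n} {Δ : Ctx n} {q : Exp n} {P : Proc n}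
    {x : Chan} {A : Ty n} (h : ImplicitTyped S C Δ q P x A) :
    ∃ E : Proc n, E.erase = P ∧ ExplicitTyped S C Δ q E x A := by
  induction h with
  | id h₁ h₂ => exact ⟨_, rfl, .id h₁ h₂⟩
  | spawn h₁ h₂ h₃ h₄ h₅ h₆ _ ih =>
    obtain ⟨E, rfl, h⟩ := ih
    exact ⟨.spawn _ _ _ _ _ E, rfl, .spawn h₁ h₂ h₃ h₄ h₅ h₆ h⟩
  | ichoiceR l h _ ih =>
    obtain ⟨E, rfl, h'⟩ := ih
    exact ⟨.sendl _ _ E, rfl, .ichoiceR l h h'⟩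
  | ichoiceL h _ ih =>
    choose E hE h' using ih
    exact ⟨.case _ _ E, by simp [Proc.erase, hE], .ichoiceL h h'⟩
  | echoiceR h _ ih =>
    choose E hE h' using ih
    exact ⟨.case _ _ E, by simp [Proc.erase, hE], .echoiceR h h'⟩
  | echoiceL l h _ ih =>
    obtain ⟨E, rfl, h'⟩ := ih
    exact ⟨.sendl _ _ E, rfl, .echoiceL l h h'⟩
  | tensorR h₁ h₂ _ ih =>
    obtain ⟨E, rfl, h⟩ := ih
    exact ⟨.send _ _ E, rfl, .tensorR h₁ h₂ h⟩
  | tensorL h₁ h₂ h₃ h₄ _ ih =>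
    obtain ⟨E, rfl, h⟩ := ih
    exact ⟨.recv _ _ E, rfl, .tensorL h₁ h₂ h₃ h₄ h⟩
  | lolliR h₁ h₂ h₃ _ ih =>
    obtain ⟨E, rfl, h⟩ := ih
    exact ⟨.recv _ _ E, rfl, .lolliR h₁ h₂ h₃ h⟩
  | lolliL h₁ h₂ _ ih =>
    obtain ⟨E, rfl, h⟩ := ih
    exact ⟨.send _ _ E, rfl, .lolliL h₁ h₂ h⟩
  | oneR h₁ h₂ => exact ⟨_, rfl, .oneR h₁ h₂⟩
  | oneL h _ ih =>
    obtain ⟨E, rfl, h'⟩ := ih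
    exact ⟨.wait _ E, rfl, .oneL h h'⟩
  | exR h₁ h₂ _ ih =>
    obtain ⟨E, rfl, h⟩ := ih
    exact ⟨.sendn _ _ E, rfl, .exR h₁ h₂ h⟩
  | exL h _ ih =>
    obtain ⟨E, rfl, h'⟩ := ih
    exact ⟨.recvn _ E, rfl, .exL h h'⟩
  | allR h _ ih =>
    obtain ⟨E, rfl, h'⟩ := ih
    exact ⟨.recvn _ E, rfl, .allR h h'⟩
  | allL h₁ h₂ _ ih =>
    obtain ⟨E, rfl, h⟩ := ih
    exact ⟨.sendn _ _ E, rfl, .allL h₁ h₂ h⟩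
  | work h _ ih =>
    obtain ⟨E, rfl, h'⟩ := ih
    exact ⟨.work _ E, rfl, .work h h'⟩
  | unsat h => exact ⟨_, rfl, .unsat h⟩
  | assertsR _ h₁ h₂ _ ih =>
    obtain ⟨E, rfl, h⟩ := ih
    exact ⟨.asserts _ _ E, rfl, .assertsR' rfl h₁ h₂ h₂ h⟩
  | assertsL _ h₁ _ ih =>
    obtain ⟨E, rfl, h⟩ := ih
    exact ⟨.assumes _ _ E, rfl, .assertsL' rfl h₁ (.and_right _ _) h⟩
  | assumesR _ h₁ _ ih =>
    obtain ⟨E, rfl, h⟩ := ih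
    exact ⟨.assumes _ _ E, rfl, .assumesR' rfl h₁ (.and_right _ _) h⟩
  | assumesL _ h₁ h₂ _ ih =>
    obtain ⟨E, rfl, h⟩ := ih
    exact ⟨.asserts _ _ E, rfl, .assumesL' rfl h₁ h₂ h₂ h⟩
  | paysR _ h₁ h₂ _ ih =>
    obtain ⟨E, rfl, h⟩ := ih
    exact ⟨.pays _ _ E, rfl, .paysR' rfl h₁ h₂ (.eq_refl _ _) h⟩
  | paysL _ h₁ _ ih =>
    obtain ⟨E, rfl, h⟩ := ih
    exact ⟨.gets _ _ E, rfl, .paysL' rfl h₁ (.eq_refl _ _) h⟩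
  | getsR _ h₁ _ ih =>
    obtain ⟨E, rfl, h⟩ := ih
    exact ⟨.gets _ _ E, rfl, .getsR' rfl h₁ (.eq_refl _ _) h⟩
  | getsL _ h₁ h₂ _ ih =>
    obtain ⟨E, rfl, h⟩ := ih
    exact ⟨.pays _ _ E, rfl, .getsL' rfl h₁ h₂ (.eq_refl _ _) h⟩
  | _ hm => cases hm

/-! ### Soundness of the forcing calculus -/

/-- The antecedents of a stage. -/
def Stage.ctx {n : ℕ} : Stage n → Ctx n
  | .inv Ω => Ω
  | .left x A => {(x, A)}
  | .right => 0

/-- Soundness: forgetting the order and the forcing turns every rule of the forcing calculus into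
a rule of the implicit system, or into a trivial step. -/
theorem Forcing.sound {S : Sig} {n : ℕ} {C : Fml n} {Δ : Ctx n} {s : Stage n} {q : Exp n}
    {P : Proc n} {x : Chan} {A : Ty n} (h : Forcing S C Δ s q P x A) :
    ImplicitTyped S C (s.ctx + Δ) q P x A := by
  have nil : ∀ {n : ℕ} (Δ : Ctx n), Stage.ctx (.inv []) + Δ = Δ := fun Δ => zero_add Δ
  have right : ∀ {n : ℕ} (Δ : Ctx n), Stage.ctx .right + Δ = Δ := fun Δ => zero_add Δ
  have cons : ∀ {n : ℕ} (Δ : Ctx n) (d Ω), Stage.ctx (.inv (d :: Ω)) + Δ =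
      d ::ₘ (Stage.ctx (.inv Ω) + Δ) := fun Δ d Ω => by
    rw [Stage.ctx, ← Multiset.cons_coe, Multiset.cons_add]; rfl
  have left : ∀ {n : ℕ} (Δ : Ctx n) (y B), Stage.ctx (.left y B) + Δ = (y, B) ::ₘ Δ :=
    fun Δ y B => Multiset.singleton_add _ _
  induction h with
  | assumesR h _ ih => exact .assumesR rfl h ih
  | getsR h _ ih => exact .getsR rfl h ih
  | assertsL _ h _ ih => rw [cons] at ih ⊢; exact .assertsL rfl h ih
  | paysL _ h _ ih => rw [cons] at ih ⊢; exact .paysL rfl h ih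
  | move _ _ _ ih => rw [cons]; rwa [Multiset.add_cons] at ih
  | forceR _ _ _ ih => exact ih
  | forceL _ _ _ ih => rw [left] at ih; rwa [nil]
  | assertsR h₁ h₂ _ ih => exact .assertsR rfl h₁ h₂ ih
  | paysR h₁ h₂ _ ih => exact .paysR rfl h₁ h₂ ih
  | assumesL h₁ h₂ _ ih => rw [left] at ih ⊢; exact .assumesL rfl h₁ h₂ ih
  | getsL h₁ h₂ _ ih => rw [left] at ih ⊢; exact .getsL rfl h₁ h₂ ih
  | unforce _ _ _ ih => rw [left]; rwa [nil] at ih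
  | id _ _ h₁ h₂ => rw [right]; exact .id h₁ h₂
  | ichoiceR l h _ ih => rw [nil] at ih; rw [right]; exact .ichoiceR l h ih
  | ichoiceL _ h _ ih =>
    rw [left]; exact .ichoiceL h fun l => by have := ih l; rwa [cons, nil] at this
  | echoiceR h _ ih =>
    rw [right]; exact .echoiceR h fun l => by have := ih l; rwa [nil] at this
  | echoiceL l _ h _ ih => rw [cons, nil] at ih; rw [left]; exact .echoiceL l h ih
  | tensorR h₁ _ h₂ _ ih => rw [nil] at ih; rw [right]; exact .tensorR h₁ h₂ ih
  | tensorL _ h₁ h₂ h₃ h₄ _ ih =>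
    rw [cons, cons, nil] at ih; rw [left]; exact .tensorL h₁ h₂ h₃ h₄ ih
  | lolliR h₁ h₂ h₃ _ ih => rw [cons, nil] at ih; rw [right]; exact .lolliR h₁ h₂ h₃ ih
  | lolliL _ h₁ _ h₂ _ ih =>
    rw [cons, nil] at ih; rw [left, Multiset.cons_swap]; exact .lolliL h₁ h₂ ih
  | oneR h₁ h₂ => rw [right]; exact .oneR h₁ h₂
  | oneL _ h _ ih => rw [nil] at ih; rw [left]; exact .oneL h ih
  | exR h₁ h₂ _ ih => rw [nil] at ih; rw [right]; exact .exR h₁ h₂ ih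
  | exL _ h _ ih => rw [cons, nil] at ih; rw [left]; exact .exL h ih
  | allR h _ ih => rw [nil] at ih; rw [right]; exact .allR h ih
  | allL _ h₁ h₂ _ ih => rw [cons, nil] at ih; rw [left]; exact .allL h₁ h₂ ih
  | spawn _ h₁ h₂ h₃ _ h₄ h₅ h₆ _ ih =>
    rw [cons, nil] at ih; rw [nil]; exact .spawn h₁ h₂ h₃ h₄ h₅ h₆ ih
  | work _ h _ ih => exact .work h ih
  | unsat _ h => exact .unsat h

/-! ### Lazy rules: undoing a strip -/

theorem Typed.unstrip_succ {S : Sig} {n : ℕ} {C : Fml n} {Δ : Ctx n} {q q' c : Exp n}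
    {P : Proc n} {x : Chan} {A A' : Ty n} (hA : Strip S C .pos A c A')
    (h : ImplicitTyped S C Δ q' P x A') (hq' : Entails C (.isNat q'))
    (hq : Entails C (.eq q (.add q' c))) : ImplicitTyped S C Δ q P x A := by
  generalize hp : Polarity.pos = p at hA
  induction hA generalizing q with
  | refl hc =>
    refine h.mono (.refl C) (hq.eq_trans fun ρ hρ => ?_)
    have := entails_eq.1 hc ρ hρ
    simp only [Exp.eval] at this
    simp only [Fml.Holds, Exp.eval]
    omega
  | asserts hu hφ _ ih => exact .assertsR rfl hu hφ (ih h hq hp)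
  | @pays A A₁ A' r c c' hu hr hc hs ih =>
    have hq₁ := fun ρ hρ => entails_eq.1 hq ρ hρ
    have hc₁ := fun ρ hρ => entails_eq.1 hc ρ hρ
    have hc' := entails_isNat.1 hs.isNat
    have hq₂ := entails_isNat.1 hq'
    simp only [Exp.eval] at hq₁ hc₁
    refine .paysR rfl hu (entails_ge.2 fun ρ hρ => ?_) (ih h (fun ρ hρ => ?_) hp)
    · have := hq₁ ρ hρ; have := hc₁ ρ hρ; have := hc' ρ hρ; have := hq₂ ρ hρ
      omega
    · have := hq₁ ρ hρ; have := hc₁ ρ hρ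
      simp only [Fml.Holds, Exp.eval]
      omega
  | assumes => cases hp
  | gets => cases hp

theorem Typed.unstrip_ante {S : Sig} {n : ℕ} {C : Fml n} {Δ : Ctx n} {q q' c : Exp n}
    {P : Proc n} {x z : Chan} {A A' Z : Ty n} (hA : Strip S C .neg A c A')
    (h : ImplicitTyped S C ((x, A') ::ₘ Δ) q' P z Z) (hq' : Entails C (.isNat q'))
    (hq : Entails C (.eq q (.add q' c))) : ImplicitTyped S C ((x, A) ::ₘ Δ) q P z Z := by
  generalize hp : Polarity.neg = p at hA
  induction hA generalizing q with
  | refl hc =>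
    refine h.mono (.refl C) (hq.eq_trans fun ρ hρ => ?_)
    have := entails_eq.1 hc ρ hρ
    simp only [Exp.eval] at this
    simp only [Fml.Holds, Exp.eval]
    omega
  | assumes hu hφ _ ih => exact .assumesL rfl hu hφ (ih h hq hp)
  | @gets A A₁ A' r c c' hu hr hc hs ih =>
    have hq₁ := fun ρ hρ => entails_eq.1 hq ρ hρ
    have hc₁ := fun ρ hρ => entails_eq.1 hc ρ hρ
    have hc' := entails_isNat.1 hs.isNat
    have hq₂ := entails_isNat.1 hq'
    simp only [Exp.eval] at hq₁ hc₁
    refine .getsL rfl hu (entails_ge.2 fun ρ hρ => ?_) (ih h (fun ρ hρ => ?_) hp)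
    · have := hq₁ ρ hρ; have := hc₁ ρ hρ; have := hc' ρ hρ; have := hq₂ ρ hρ
      omega
    · have := hq₁ ρ hρ; have := hc₁ ρ hρ
      simp only [Fml.Holds, Exp.eval]
      omega
  | asserts => cases hp
  | pays => cases hp

theorem Typed.unstrip_ctx {S : Sig} {n : ℕ} {C : Fml n} {Δ Δ' Γ : Ctx n} {q q' c : Exp n}
    {P : Proc n} {z : Chan} {Z : Ty n} (hΔ : CtxStrip S C .neg Δ c Δ')
    (h : ImplicitTyped S C (Γ + Δ') q' P z Z) (hq' : Entails C (.isNat q'))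
    (hq : Entails C (.eq q (.add q' c))) : ImplicitTyped S C (Γ + Δ) q P z Z := by
  induction hΔ generalizing Γ q with
  | nil hc =>
    refine h.mono (.refl C) (hq.eq_trans fun ρ hρ => ?_)
    have := entails_eq.1 hc ρ hρ
    simp only [Exp.eval] at this
    simp only [Fml.Holds, Exp.eval]
    omega
  | @cons Δ Δ' x A A' a b c hA hΔ hc ih =>
    rw [Multiset.add_cons, ← Multiset.cons_add] at h
    have h' := ih h (.eq_refl C (.add q' b))
    rw [Multiset.cons_add] at h'
    rw [Multiset.add_cons]
    have hb := entails_isNat.1 hΔ.isNat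
    have hq₂ := entails_isNat.1 hq'
    refine Typed.unstrip_ante hA h' (entails_isNat.2 fun ρ hρ => ?_) (hq.eq_trans fun ρ hρ => ?_)
    · exact add_nonneg (hq₂ ρ hρ) (hb ρ hρ)
    · have := entails_eq.1 hc ρ hρ
      simp only [Exp.eval] at this
      simp only [Fml.Holds, Exp.eval]
      omega

/-- `▷`, `?` on the right and `◁`, `!` on the left can be postponed: if the rest of the derivation
starts from stripped types, it can start from the original ones. -/
theorem Typed.unstrip {S : Sig} {n : ℕ} {C : Fml n} {Δ Δ' Γ : Ctx n} {q q' c a : Exp n}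
    {P : Proc n} {z : Chan} {Z Z' : Ty n} (hΔ : CtxStrip S C .neg Δ c Δ')
    (hZ : Strip S C .pos Z a Z') (h : ImplicitTyped S C (Γ + Δ') q' P z Z')
    (hq' : Entails C (.isNat q')) (hq : Entails C (.eq q (.add q' (.add c a)))) :
    ImplicitTyped S C (Γ + Δ) q P z Z := by
  have hc := entails_isNat.1 hΔ.isNat
  refine Typed.unstrip_succ hZ (Typed.unstrip_ctx hΔ h hq' (.eq_refl C (.add q' c)))
    (entails_isNat.2 fun ρ hρ => add_nonneg (entails_isNat.1 hq' ρ hρ) (hc ρ hρ))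
    (hq.eq_trans fun ρ hρ => ?_)
  simp only [Fml.Holds, Exp.eval]
  omega

/-! ### Invertible rules -/

theorem structural_of_unfold {S : Sig} {n : ℕ} {A B : Ty n} (h : S.unfold A = B)
    (hB : B.IsStructuralHead) : Structural S A := by
  rw [Structural, h]; exact hB

theorem Ty.Polarized.of_unfold {S : Sig} (hS : S.WellFormed) {n : ℕ} {A B : Ty n}
    (hA : A.Polarized S) (h : S.unfold A = B) : B.Polarized S := h ▸ hA.unfold hS

theorem polarized_weaken {S : Sig} {n : ℕ} {Δ : Ctx n} (h : ∀ d ∈ Δ, d.2.Polarized S) :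
    ∀ d ∈ Δ.weaken, d.2.Polarized S := by
  intro d hd
  obtain ⟨d', hd', rfl⟩ := Multiset.mem_map.1 hd
  exact (h d' hd').subst _

/-- A type equal to a structural type is structural, so stripping it does nothing, unless the
constraints are contradictory, and then all types are equal. -/
theorem Strip.tyEq_structural {S : Sig} {n : ℕ} {C : Fml n} {p : Polarity} {A A' B : Ty n}
    {c : Exp n} (h : Strip S C p A c A') (hAB : TyEq S C A B) (hB : Structural S B) :
    TyEq S C A' B ∧ Entails C (.eq c (.const 0)) := by
  rcases entails_ff_or_satisfiable C with hC | hC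
  · exact ⟨.of_unsat _ _ hC, fun ρ hρ => (hC ρ hρ).elim⟩
  · obtain ⟨rfl, hc⟩ := h.eq_of_structural (hAB.symm.structural hC hB)
    exact ⟨hAB, hc⟩

theorem CtxStrip.of_cons_tyEq {S : Sig} {n : ℕ} {C : Fml n} {p : Polarity} {Δ Δ' : Ctx n}
    {c : Exp n} {w : Chan} {A B : Ty n} (h : CtxStrip S C p ((w, A) ::ₘ Δ) c Δ')
    (hAB : TyEq S C A B) (hB : Structural S B) :
    ∃ A' Δ₁, Δ' = (w, A') ::ₘ Δ₁ ∧ TyEq S C A' B ∧ CtxStrip S C p Δ c Δ₁ := by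
  obtain ⟨A', Δ₁, a, b, rfl, hA, hΔ, hc⟩ := h.of_cons_left
  obtain ⟨hA'B, ha⟩ := hA.tyEq_structural hAB hB
  refine ⟨A', Δ₁, rfl, hA'B, hΔ.congr (hc.eq_trans fun ρ hρ => ?_)⟩
  have := entails_eq.1 ha ρ hρ
  simp only [Exp.eval] at this
  simp only [Fml.Holds, Exp.eval]
  omega

theorem CtxStrip.of_cons_structural {S : Sig} {n : ℕ} {C : Fml n} {p : Polarity} {Δ Δ' : Ctx n}
    {c : Exp n} {x : Chan} {A : Ty n} (h : CtxStrip S C p ((x, A) ::ₘ Δ) c Δ')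
    (hA : Structural S A) :
    ∃ Δ₁, Δ' = (x, A) ::ₘ Δ₁ ∧ CtxStrip S C p Δ c Δ₁ := by
  obtain ⟨A', Δ₁, a, b, rfl, hs, hΔ, hc⟩ := h.of_cons_left
  obtain ⟨rfl, ha⟩ := hs.eq_of_structural hA
  refine ⟨Δ₁, rfl, hΔ.congr (hc.eq_trans fun ρ hρ => ?_)⟩
  have := entails_eq.1 ha ρ hρ
  simp only [Exp.eval] at this
  simp only [Fml.Holds, Exp.eval]
  omega

theorem MatchArgs.of_ctxStrip {S : Sig} {n k : ℕ} {C : Fml n} {p : Polarity}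
    {D : List (Chan × Ty n)} {ys : List Chan} {e : Fin k → Exp n} {Bs : List (Ty k)}
    {Δ Γ : Ctx n} {c : Exp n} (h : MatchArgs S C D ys e Bs) (hBs : ∀ B ∈ Bs, Structural S B)
    (hΓ : CtxStrip S C p ((D : Ctx n) + Δ) c Γ) :
    ∃ (D' : List (Chan × Ty n)) (Δ' : Ctx n), Γ = (D' : Ctx n) + Δ' ∧
      MatchArgs S C D' ys e Bs ∧ CtxStrip S C p Δ c Δ' := by
  induction D generalizing ys Bs Γ with
  | nil => exact ⟨[], Γ, (zero_add Γ).symm, h, by rwa [Multiset.coe_nil, zero_add] at hΓ⟩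
  | cons d D ih =>
    obtain ⟨rfl, h⟩ := h
    cases h with
    | @cons _ B _ Bs h h' =>
    rw [← Multiset.cons_coe, Multiset.cons_add] at hΓ
    rw [List.forall_mem_cons] at hBs
    obtain ⟨A', Γ', rfl, hA', hΓ'⟩ := hΓ.of_cons_tyEq h (hBs.1.subst e)
    obtain ⟨D', Δ', rfl, hD', hΔ'⟩ := ih ⟨rfl, h'⟩ hBs.2 hΓ'
    refine ⟨(d.1, A') :: D', Δ', ?_, ⟨?_, .cons hA' hD'.2⟩, hΔ'⟩
    · rw [← Multiset.cons_coe, Multiset.cons_add]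
    · simp [hD'.1]

theorem Sig.WellFormed.structural_args {S : Sig} (hS : S.WellFormed) {k f : ℕ} {F : PDecl k}
    (hF : S.pdecl k f = some F) : ∀ B ∈ F.args, Structural S B := fun B hB =>
  (hS.decl hF B (List.mem_cons_of_mem _ hB)).2.2

/-- The forwarding case of invertibility. Both endpoints have equal types, so at most one of them
is stripped properly, and the other one follows by lazy rules. -/
theorem Typed.fwd_of_strip {S : Sig} {n : ℕ} {C : Fml n} {q a b : Exp n} {x y : Chan}
    {A A' B B' : Ty n} (hAB : TyEq S C A B) (hA : Strip S C .pos A a A')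
    (hB : Strip S C .neg B b B') (hq : Entails C (.eq q (.add a b))) :
    ImplicitTyped S C {(y, A')} q (.fwd x y) x B' := by
  rcases entails_ff_or_satisfiable C with hC | hC
  · exact .id (fun ρ hρ => (hC ρ hρ).elim) (.of_unsat _ _ hC)
  have h0 : Entails C (.isNat (.const 0)) := entails_isNat.2 fun ρ hρ => le_rfl
  obtain ⟨B₁, hB₁, hA'B₁⟩ := hA.of_tyEq hC hAB
  have alt : (B' = B ∧ Entails C (.eq b (.const 0))) ∨ (B₁ = B ∧ Entails C (.eq a (.const 0))) := by
    cases hB with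
    | refl hb => exact .inl ⟨rfl, hb⟩
    | assumes hu =>
      exact .inr (hB₁.eq_of_unfold ⟨fun _ _ h => by simp [hu] at h, fun _ _ h => by simp [hu] at h⟩)
    | gets hu =>
      exact .inr (hB₁.eq_of_unfold ⟨fun _ _ h => by simp [hu] at h, fun _ _ h => by simp [hu] at h⟩)
  rcases alt with ⟨rfl, hb⟩ | ⟨rfl, ha⟩
  · refine Typed.unstrip_succ hB₁ (.id (.eq_refl C (.const 0)) hA'B₁) h0
      (hq.eq_trans fun ρ hρ => ?_)
    have := entails_eq.1 hb ρ hρ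
    simp only [Exp.eval] at this
    simp only [Fml.Holds, Exp.eval]
    omega
  · obtain ⟨A₁, hA₁, hB'A₁⟩ := hB.of_tyEq hC hA'B₁.symm
    refine Typed.unstrip_ante (Δ := 0) hA₁ (.id (.eq_refl C (.const 0)) hB'A₁.symm) h0
      (hq.eq_trans fun ρ hρ => ?_)
    have := entails_eq.1 ha ρ hρ
    simp only [Exp.eval] at this
    simp only [Fml.Holds, Exp.eval]
    omega

/-- Invertibility of `?`, `▷` on the left and `!`, `◁` on the right, for all channels at once: the
stripped sequent is derivable with the potential that the stripped constructors bring in. -/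
theorem Typed.strip {S : Sig} (hS : S.WellFormed) {n : ℕ} {C : Fml n} {Δ Δ' : Ctx n}
    {q q' c a : Exp n} {P : Proc n} {x : Chan} {A A' : Ty n}
    (h : ImplicitTyped S C Δ q P x A) (hΔ : ∀ d ∈ Δ, d.2.Polarized S) (hA : A.Polarized S)
    (hsΔ : CtxStrip S C .pos Δ c Δ') (hsA : Strip S C .neg A a A')
    (hq : Entails C (.eq q' (.add q (.add c a)))) : ImplicitTyped S C Δ' q' P x A' := by
  induction h with
  | @id n C q x y A B h₁ h₂ =>
    obtain ⟨A₁, Δ₁, a₁, b, rfl, hs, hΔ₁, hc⟩ := CtxStrip.of_cons_left (Δ := 0) hsΔ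
    obtain ⟨rfl, hb⟩ := hΔ₁.eq_zero_left
    refine Typed.fwd_of_strip h₂ hs hsA (hq.eq_trans fun ρ hρ => ?_)
    have e₁ := entails_eq.1 h₁ ρ hρ
    have e₂ := entails_eq.1 hb ρ hρ
    have e₃ := entails_eq.1 hc ρ hρ
    simp only [Exp.eval] at e₁ e₂ e₃
    simp only [Fml.Holds, Exp.eval]
    omega
  | spawn h₁ h₂ h₃ h₄ h₅ h₆ _ ih =>
    obtain ⟨D', Δ₁, rfl, hD', hΔ₁⟩ := h₄.of_ctxStrip (hS.structural_args h₁) hsΔ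
    have hF := hS.decl h₁ _ (List.mem_cons_self ..)
    exact .spawn h₁ h₂ (h₃.ge_of_eq_add hsΔ.isNat hsA.isNat hq) hD' ((hΔ₁.fresh_iff _).1 h₅) h₆
      (ih (Multiset.forall_mem_cons.2 ⟨hF.2.1.subst _, fun d hd => hΔ d
        (Multiset.mem_add.2 (.inr hd))⟩) hA (hΔ₁.cons_refl _) hsA (hq.sub_eq_add _))
  | ichoiceR l h _ ih =>
    obtain ⟨rfl, ha⟩ := hsA.eq_of_structural (structural_of_unfold h trivial)
    exact .ichoiceR l h (ih hΔ (hA.of_unfold hS h l) hsΔ (.refl ha) hq)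
  | ichoiceL h _ ih =>
    obtain ⟨Δ₁, rfl, hΔ₁⟩ := hsΔ.of_cons_structural (structural_of_unfold h trivial)
    rw [Multiset.forall_mem_cons] at hΔ
    exact .ichoiceL h fun l => ih l
      (Multiset.forall_mem_cons.2 ⟨hΔ.1.of_unfold hS h l, hΔ.2⟩) hA (hΔ₁.cons_refl _) hsA hq
  | echoiceR h _ ih =>
    obtain ⟨rfl, ha⟩ := hsA.eq_of_structural (structural_of_unfold h trivial)
    exact .echoiceR h fun l => ih l hΔ (hA.of_unfold hS h l) hsΔ (.refl ha) hq
  | echoiceL l h _ ih =>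
    obtain ⟨Δ₁, rfl, hΔ₁⟩ := hsΔ.of_cons_structural (structural_of_unfold h trivial)
    rw [Multiset.forall_mem_cons] at hΔ
    exact .echoiceL l h (ih
      (Multiset.forall_mem_cons.2 ⟨hΔ.1.of_unfold hS h l, hΔ.2⟩) hA (hΔ₁.cons_refl _) hsA hq)
  | tensorR h₁ h₂ _ ih =>
    obtain ⟨rfl, ha⟩ := hsA.eq_of_structural (structural_of_unfold h₁ trivial)
    have hT := hA.of_unfold hS h₁
    obtain ⟨A', Δ₁, rfl, hA', hΔ₁⟩ := hsΔ.of_cons_tyEq h₂ hT.1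
    exact .tensorR h₁ hA' (ih (Multiset.forall_mem_cons.1 hΔ).2 hT.2.2 hΔ₁ (.refl ha) hq)
  | tensorL h₁ h₂ h₃ h₄ _ ih =>
    obtain ⟨Δ₁, rfl, hΔ₁⟩ := hsΔ.of_cons_structural (structural_of_unfold h₁ trivial)
    rw [Multiset.forall_mem_cons] at hΔ
    have hT := hΔ.1.of_unfold hS h₁
    exact .tensorL h₁ ((hΔ₁.fresh_iff _).1 h₂) h₃ h₄
      (ih (Multiset.forall_mem_cons.2 ⟨hT.2.1, Multiset.forall_mem_cons.2 ⟨hT.2.2, hΔ.2⟩⟩) hA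
        ((hΔ₁.cons_refl _).cons_refl _) hsA hq)
  | lolliR h₁ h₂ h₃ _ ih =>
    obtain ⟨rfl, ha⟩ := hsA.eq_of_structural (structural_of_unfold h₁ trivial)
    have hT := hA.of_unfold hS h₁
    exact .lolliR h₁ ((hsΔ.fresh_iff _).1 h₂) h₃
      (ih (Multiset.forall_mem_cons.2 ⟨hT.2.1, hΔ⟩) hT.2.2 (hsΔ.cons_refl _) (.refl ha) hq)
  | lolliL h₁ h₂ _ ih =>
    rw [Multiset.forall_mem_cons, Multiset.forall_mem_cons] at hΔ
    have hT := hΔ.2.1.of_unfold hS h₁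
    obtain ⟨A', Δ₁, rfl, hA', hΔ₁⟩ := hsΔ.of_cons_tyEq h₂ hT.1
    obtain ⟨Δ₂, rfl, hΔ₂⟩ := hΔ₁.of_cons_structural (structural_of_unfold h₁ trivial)
    exact .lolliL h₁ hA' (ih (Multiset.forall_mem_cons.2 ⟨hT.2.2, hΔ.2.2⟩) hA
      (hΔ₂.cons_refl _) hsA hq)
  | oneR h₁ h₂ =>
    obtain ⟨rfl, ha⟩ := hsA.eq_of_structural (structural_of_unfold h₁ trivial)
    obtain ⟨rfl, hc⟩ := hsΔ.eq_zero_left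
    refine .oneR h₁ (hq.eq_trans fun ρ hρ => ?_)
    have e₁ := entails_eq.1 h₂ ρ hρ
    have e₂ := entails_eq.1 ha ρ hρ
    have e₃ := entails_eq.1 hc ρ hρ
    simp only [Exp.eval] at e₁ e₂ e₃
    simp only [Fml.Holds, Exp.eval]
    omega
  | oneL h _ ih =>
    obtain ⟨Δ₁, rfl, hΔ₁⟩ := hsΔ.of_cons_structural (structural_of_unfold h trivial)
    exact .oneL h (ih (Multiset.forall_mem_cons.1 hΔ).2 hA hΔ₁ hsA hq)
  | exR h₁ h₂ _ ih =>
    obtain ⟨rfl, ha⟩ := hsA.eq_of_structural (structural_of_unfold h₁ trivial)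
    exact .exR h₁ h₂ (ih hΔ (Ty.Polarized.subst _ (hA.of_unfold hS h₁)) hsΔ (.refl ha) hq)
  | exL h _ ih =>
    obtain ⟨Δ₁, rfl, hΔ₁⟩ := hsΔ.of_cons_structural (structural_of_unfold h trivial)
    rw [Multiset.forall_mem_cons] at hΔ
    exact .exL h (ih (Multiset.forall_mem_cons.2 ⟨hΔ.1.of_unfold hS h, polarized_weaken hΔ.2⟩)
      (hA.subst _) (hΔ₁.weaken.cons_refl _) hsA.weaken hq.weaken)
  | allR h _ ih =>
    obtain ⟨rfl, ha⟩ := hsA.eq_of_structural (structural_of_unfold h trivial)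
    exact .allR h (ih (polarized_weaken hΔ) (hA.of_unfold hS h) hsΔ.weaken
      (.refl ha.weaken) hq.weaken)
  | allL h₁ h₂ _ ih =>
    obtain ⟨Δ₁, rfl, hΔ₁⟩ := hsΔ.of_cons_structural (structural_of_unfold h₁ trivial)
    rw [Multiset.forall_mem_cons] at hΔ
    exact .allL h₁ h₂ (ih (Multiset.forall_mem_cons.2
      ⟨Ty.Polarized.subst _ (hΔ.1.of_unfold hS h₁), hΔ.2⟩) hA (hΔ₁.cons_refl _) hsA hq)
  | work h _ ih =>
    exact .work (h.ge_of_eq_add hsΔ.isNat hsA.isNat hq) (ih hΔ hA hsΔ hsA (hq.sub_eq_add _))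
  | unsat h => exact .unsat h
  | assertsR _ h₁ h₂ _ ih =>
    obtain ⟨rfl, ha⟩ := hsA.eq_of_unfold (by simp [h₁])
    exact .assertsR rfl h₁ h₂ (ih hΔ (hA.of_unfold hS h₁).2 hsΔ (.refl ha) hq)
  | paysR _ h₁ h₂ _ ih =>
    obtain ⟨rfl, ha⟩ := hsA.eq_of_unfold (by simp [h₁])
    exact .paysR rfl h₁ (h₂.ge_of_eq_add hsΔ.isNat hsA.isNat hq)
      (ih hΔ (hA.of_unfold hS h₁).2 hsΔ (.refl ha) (hq.sub_eq_add _))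
  | assumesL _ h₁ h₂ _ ih =>
    obtain ⟨A', Δ₁, a', b, rfl, hs, hΔ₁, hc⟩ := hsΔ.of_cons_left
    obtain ⟨rfl, ha'⟩ := hs.eq_of_unfold (by simp [h₁])
    rw [Multiset.forall_mem_cons] at hΔ
    exact .assumesL rfl h₁ h₂ (ih (Multiset.forall_mem_cons.2 ⟨(hΔ.1.of_unfold hS h₁).2, hΔ.2⟩) hA
      (.cons (.refl ha') hΔ₁ hc) hsA hq)
  | getsL _ h₁ h₂ _ ih =>
    obtain ⟨A', Δ₁, a', b, rfl, hs, hΔ₁, hc⟩ := hsΔ.of_cons_left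
    obtain ⟨rfl, ha'⟩ := hs.eq_of_unfold (by simp [h₁])
    rw [Multiset.forall_mem_cons] at hΔ
    exact .getsL rfl h₁ (h₂.ge_of_eq_add hsΔ.isNat hsA.isNat hq)
      (ih (Multiset.forall_mem_cons.2 ⟨(hΔ.1.of_unfold hS h₁).2, hΔ.2⟩) hA
        (.cons (.refl ha') hΔ₁ hc) hsA (hq.sub_eq_add _))
  | @assertsL n C φ Δ q Q x z A A₁ Z _ h₁ _ ih =>
    obtain ⟨A', Δ₁, a', b, rfl, hs, hΔ₁, hc⟩ := hsΔ.of_cons_left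
    rw [Multiset.forall_mem_cons] at hΔ
    have hΔ' : ∀ d ∈ (x, A₁) ::ₘ Δ, d.2.Polarized S :=
      Multiset.forall_mem_cons.2 ⟨(hΔ.1.of_unfold hS h₁).2, hΔ.2⟩
    cases hs with
    | refl ha' =>
      have hC := Entails.and_left C φ
      exact .assertsL rfl h₁ (ih hΔ' hA (.cons (.refl (hC.trans ha')) (hΔ₁.mono hC)
        (hC.trans hc)) (hsA.mono hC) (hC.trans hq))
    | asserts hu hφ hs =>
      rw [h₁] at hu
      cases hu
      -- the principal type is itself stripped, so the assumption of the premise is provable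
      have hC := Entails.and_left C φ
      exact (ih hΔ' hA (.cons (hs.mono hC) (hΔ₁.mono hC) (hC.trans hc))
        (hsA.mono hC) (hC.trans hq)).mono (.and_intro (.refl _) hφ) (.eq_refl _ _)
    | pays hu => rw [h₁] at hu; cases hu
  | @paysL n C Δ q r Q x z A A₁ Z _ h₁ _ ih =>
    obtain ⟨A', Δ₁, a', b, rfl, hs, hΔ₁, hc⟩ := hsΔ.of_cons_left
    rw [Multiset.forall_mem_cons] at hΔ
    have hΔ' : ∀ d ∈ (x, A₁) ::ₘ Δ, d.2.Polarized S :=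
      Multiset.forall_mem_cons.2 ⟨(hΔ.1.of_unfold hS h₁).2, hΔ.2⟩
    cases hs with
    | refl ha' =>
      exact .paysL rfl h₁ (ih hΔ' hA (.cons (.refl ha') hΔ₁ hc) hsA (hq.add_eq_add _))
    | pays hu hr ha' hs =>
      rw [h₁] at hu
      cases hu
      refine ih hΔ' hA (.cons hs hΔ₁ (.eq_refl _ _)) hsA (hq.eq_trans fun ρ hρ => ?_)
      have e₁ := entails_eq.1 ha' ρ hρ
      have e₂ := entails_eq.1 hc ρ hρ
      simp only [Exp.eval] at e₁ e₂
      simp only [Fml.Holds, Exp.eval]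
      omega
    | asserts hu => rw [h₁] at hu; cases hu
  | @assumesR n C φ _ _ _ _ _ _ _ h₁ _ ih =>
    have hA' := (hA.of_unfold hS h₁).2
    cases hsA with
    | refl ha =>
      have hC := Entails.and_left C φ
      exact .assumesR rfl h₁ (ih hΔ hA' (hsΔ.mono hC) (.refl (hC.trans ha))
        (hC.trans hq))
    | assumes hu hφ hs =>
      rw [h₁] at hu
      cases hu
      -- as above, the assumption of the premise is provable
      have hC := Entails.and_left C φ
      exact (ih hΔ hA' (hsΔ.mono hC) (hs.mono hC) (hC.trans hq)).mono
        (.and_intro (.refl _) hφ) (.eq_refl _ _)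
    | gets hu => rw [h₁] at hu; cases hu
  | getsR _ h₁ _ ih =>
    have hA' := (hA.of_unfold hS h₁).2
    cases hsA with
    | refl ha => exact .getsR rfl h₁ (ih hΔ hA' hsΔ (.refl ha) (hq.add_eq_add _))
    | gets hu hr ha hs =>
      rw [h₁] at hu
      cases hu
      refine ih hΔ hA' hsΔ hs (hq.eq_trans fun ρ hρ => ?_)
      have e₁ := entails_eq.1 ha ρ hρ
      simp only [Exp.eval] at e₁
      simp only [Fml.Holds, Exp.eval]
      omega
    | assumes hu => rw [h₁] at hu; cases hu
  | _ hm => cases hm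

/-! ### Proper types -/

/-- Valid and polarized types. -/
def Ty.Proper (S : Sig) {n : ℕ} (C : Fml n) (A : Ty n) : Prop := A.Valid S C ∧ A.Polarized S

namespace Ty.Proper

variable {S : Sig} {n : ℕ} {C : Fml n} {A B : Ty n}

theorem of_unfold (h : A.Proper S C) (hS : S.WellFormed) (hu : S.unfold A = B) : B.Proper S C :=
  ⟨hu ▸ h.1.unfold hS, h.2.of_unfold hS hu⟩

theorem mono {C' : Fml n} (h : A.Proper S C) (hC : Entails C' C) : A.Proper S C' :=
  ⟨h.1.mono hC, h.2⟩

theorem weaken (h : A.Proper S C) : A.weaken.Proper S C.weaken :=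
  ⟨h.1.subst (.weaken C), h.2.subst _⟩

theorem ichoice {L : Finset Label} {As : L → Ty n} (h : (Ty.ichoice L As).Proper S C) (l : L) :
    (As l).Proper S C := ⟨h.1 l, h.2 l⟩

theorem echoice {L : Finset Label} {As : L → Ty n} (h : (Ty.echoice L As).Proper S C) (l : L) :
    (As l).Proper S C := ⟨h.1 l, h.2 l⟩

theorem tensor (h : (Ty.tensor A B).Proper S C) :
    Structural S A ∧ A.Proper S C ∧ B.Proper S C :=
  ⟨h.2.1, ⟨h.1.1, h.2.2.1⟩, ⟨h.1.2, h.2.2.2⟩⟩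

theorem lolli (h : (Ty.lolli A B).Proper S C) :
    Structural S A ∧ A.Proper S C ∧ B.Proper S C :=
  ⟨h.2.1, ⟨h.1.1, h.2.2.1⟩, ⟨h.1.2, h.2.2.2⟩⟩

theorem asserts {φ : Fml n} (h : (Ty.asserts φ A).Proper S C) : A.Proper S (C.and φ) :=
  ⟨h.1, h.2.2⟩

theorem assumes {φ : Fml n} (h : (Ty.assumes φ A).Proper S C) : A.Proper S (C.and φ) :=
  ⟨h.1, h.2.2⟩

theorem pays {r : Exp n} (h : (Ty.pays r A).Proper S C) :
    Entails C (.isNat r) ∧ A.Proper S C := ⟨h.1.1, h.1.2, h.2.2⟩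

theorem gets {r : Exp n} (h : (Ty.gets r A).Proper S C) :
    Entails C (.isNat r) ∧ A.Proper S C := ⟨h.1.1, h.1.2, h.2.2⟩

theorem ex {A : Ty (n + 1)} (h : (Ty.ex A).Proper S C) : A.Proper S C.weaken := ⟨h.1, h.2⟩

theorem all {A : Ty (n + 1)} (h : (Ty.all A).Proper S C) : A.Proper S C.weaken := ⟨h.1, h.2⟩

theorem inst {A : Ty (n + 1)} (h : A.Proper S C.weaken) {e : Exp n}
    (he : Entails C (.isNat e)) : (A.inst e).Proper S C :=
  ⟨h.1.subst (.inst he), h.2.subst _⟩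

theorem strip (h : A.Proper S C) (hS : S.WellFormed) {p : Polarity} {c : Exp n}
    (hs : Strip S C p A c B) : B.Proper S C := by
  induction hs with
  | refl => exact h
  | asserts hu hφ _ ih => exact ih ((h.of_unfold hS hu).asserts.mono (.and_intro (.refl C) hφ))
  | assumes hu hφ _ ih => exact ih ((h.of_unfold hS hu).assumes.mono (.and_intro (.refl C) hφ))
  | pays hu _ _ _ ih => exact ih (h.of_unfold hS hu).pays.2
  | gets hu _ _ _ ih => exact ih (h.of_unfold hS hu).gets.2

end Ty.Proper

/-- The antecedents of a stable sequent: their types are proper and negative. -/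
def StableCtx (S : Sig) {n : ℕ} (C : Fml n) (Δ : Ctx n) : Prop :=
  ∀ d ∈ Δ, d.2.Proper S C ∧ Negative S d.2

theorem StableCtx.mono {S : Sig} {n : ℕ} {C C' : Fml n} {Δ : Ctx n} (h : StableCtx S C Δ)
    (hC : Entails C' C) : StableCtx S C' Δ := fun d hd => ⟨(h d hd).1.mono hC, (h d hd).2⟩

theorem StableCtx.weaken {S : Sig} {n : ℕ} {C : Fml n} {Δ : Ctx n} (h : StableCtx S C Δ) :
    StableCtx S C.weaken Δ.weaken := by
  intro d hd
  obtain ⟨d', hd', rfl⟩ := Multiset.mem_map.1 hd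
  exact ⟨(h d' hd').1.weaken, (h d' hd').2.subst _⟩

theorem stableCtx_cons {S : Sig} {n : ℕ} {C : Fml n} {Δ : Ctx n} {x : Chan} {A : Ty n} :
    StableCtx S C ((x, A) ::ₘ Δ) ↔ (A.Proper S C ∧ Negative S A) ∧ StableCtx S C Δ :=
  Multiset.forall_mem_cons

theorem Positive.of_unfold {S : Sig} {n : ℕ} {A : Ty n} (h : Positive S A) :
    (∀ φ A', S.unfold A ≠ .assumes φ A') ∧ ∀ r A', S.unfold A ≠ .gets r A' := by
  cases h with
  | structural h =>
    constructor <;> intro _ _ hu <;> rw [Structural, hu] at h <;> exact h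
  | asserts h => simp [h]
  | pays h => simp [h]

theorem Negative.of_unfold {S : Sig} {n : ℕ} {A : Ty n} (h : Negative S A) :
    (∀ φ A', S.unfold A ≠ .asserts φ A') ∧ ∀ r A', S.unfold A ≠ .pays r A' := by
  cases h with
  | structural h =>
    constructor <;> intro _ _ hu <;> rw [Structural, hu] at h <;> exact h
  | assumes h => simp [h]
  | gets h => simp [h]

/-! ### Channels that are handed over -/

theorem Negative.strip_of_unsat {S : Sig} {n : ℕ} {C : Fml n} {A : Ty n} (h : Negative S A)
    (hC : Entails C .ff) : ∃ B, Strip S C .neg A (.const 0) B ∧ Structural S B := by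
  have any : ∀ φ, Entails C φ := fun _ ρ hρ => (hC ρ hρ).elim
  induction h with
  | structural h => exact ⟨_, .zero _, h⟩
  | assumes hu _ ih =>
    obtain ⟨B, h₁, h₂⟩ := ih
    exact ⟨B, .assumes hu (any _) h₁, h₂⟩
  | gets hu _ ih =>
    obtain ⟨B, h₁, h₂⟩ := ih
    exact ⟨B, .gets hu (any _) (any _) h₁, h₂⟩

theorem Positive.strip_of_unsat {S : Sig} {n : ℕ} {C : Fml n} {A : Ty n} (h : Positive S A)
    (hC : Entails C .ff) : ∃ B, Strip S C .pos A (.const 0) B ∧ Structural S B := by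
  have any : ∀ φ, Entails C φ := fun _ ρ hρ => (hC ρ hρ).elim
  induction h with
  | structural h => exact ⟨_, .zero _, h⟩
  | asserts hu _ ih =>
    obtain ⟨B, h₁, h₂⟩ := ih
    exact ⟨B, .asserts hu (any _) h₁, h₂⟩
  | pays hu _ ih =>
    obtain ⟨B, h₁, h₂⟩ := ih
    exact ⟨B, .pays hu (any _) (any _) h₁, h₂⟩

/-- A negative and a positive type can only be equal if both are structural. -/
theorem TyEq.structural_of_negative_of_positive {S : Sig} {n : ℕ} {C : Fml n} {A B : Ty n}
    (h : TyEq S C A B) (hC : Satisfiable C) (hA : Negative S A) (hB : Positive S B) :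
    Structural S B := by
  have hC' := hC
  obtain ⟨ρ, hρ⟩ := hC
  cases hA with
  | structural hA => exact h.structural hC' hA
  | assumes hA =>
    have hm := h.headMatch hρ
    cases hB with
    | structural hB => exact hB
    | asserts hB => rw [hA, hB] at hm; exact hm.elim
    | pays hB => rw [hA, hB] at hm; exact hm.elim
  | gets hA =>
    have hm := h.headMatch hρ
    cases hB with
    | structural hB => exact hB
    | asserts hB => rw [hA, hB] at hm; exact hm.elim
    | pays hB => rw [hA, hB] at hm; exact hm.elim

theorem TyEq.exists_structural_right {S : Sig} {n : ℕ} {C : Fml n} {A B : Ty n}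
    (h : TyEq S C A B) (hA : Negative S A) (hB : Positive S B) :
    ∃ B', Strip S C .pos B (.const 0) B' ∧ Structural S B' ∧ TyEq S C A B' := by
  rcases entails_ff_or_satisfiable C with hC | hC
  · obtain ⟨B', h₁, h₂⟩ := hB.strip_of_unsat hC
    exact ⟨B', h₁, h₂, .of_unsat _ _ hC⟩
  · exact ⟨B, .zero _, h.structural_of_negative_of_positive hC hA hB, h⟩

theorem TyEq.exists_structural_left {S : Sig} {n : ℕ} {C : Fml n} {A B : Ty n}
    (h : TyEq S C A B) (hA : Negative S A) (hB : Structural S B) :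
    ∃ A', Strip S C .neg A (.const 0) A' ∧ Structural S A' ∧ TyEq S C A' B := by
  rcases entails_ff_or_satisfiable C with hC | hC
  · obtain ⟨A', h₁, h₂⟩ := hA.strip_of_unsat hC
    exact ⟨A', h₁, h₂, .of_unsat _ _ hC⟩
  · exact ⟨A, .zero _, h.symm.structural hC hB, h⟩

theorem Strip.trans_zero {S : Sig} {n : ℕ} {C : Fml n} {p : Polarity} {A A' B : Ty n}
    {c : Exp n} (h : Strip S C p A c A') (h' : Strip S C p A' (.const 0) B) :
    Strip S C p A c B :=
  h.trans h' fun _ _ => (add_zero _).symm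

/-! ### Forcing a channel -/

section Force

variable {S : Sig} {n : ℕ} {C : Fml n} {Δ : Ctx n} {P : Proc n} {y z : Chan}
  {q q' a b c c₁ : Exp n} {B B' Z Z' : Ty n}

theorem Forcing.left_of_strip (h : Strip S C .neg B c B') (hq : Entails C (.ge q c))
    (k : ∀ q', Entails C (.eq q (.add q' c)) → Forcing S C Δ (.left y B') q' P z Z) :
    Forcing S C Δ (.left y B) q P z Z := by
  generalize hp : Polarity.neg = p at h
  induction h generalizing q with
  | refl hc =>
    exact k q fun ρ hρ => by
      have := entails_eq.1 hc ρ hρ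
      simp only [Exp.eval] at this
      simp only [Fml.Holds, Exp.eval]
      omega
  | assumes hu hφ _ ih => exact .assumesL hu hφ (ih hq k hp)
  | @gets B B₁ B' r c c' hu hr hc hs ih =>
    have hq := entails_ge.1 hq
    have hc := fun ρ hρ => entails_eq.1 hc ρ hρ
    have hc' := entails_isNat.1 hs.isNat
    simp only [Exp.eval] at hc
    refine .getsL hu (entails_ge.2 fun ρ hρ => ?_) (ih (entails_ge.2 fun ρ hρ => ?_)
      (fun q' h => k q' fun ρ hρ => ?_) hp)
    · have := hq ρ hρ; have := hc ρ hρ; have := hc' ρ hρ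
      omega
    · have := hq ρ hρ; have := hc ρ hρ
      simp only [Exp.eval]
      omega
    · have e := entails_eq.1 h ρ hρ; have := hc ρ hρ
      simp only [Exp.eval] at e
      simp only [Fml.Holds, Exp.eval]
      omega
  | asserts => cases hp
  | pays => cases hp

theorem Forcing.right_of_strip (h : Strip S C .pos Z c Z') (hq : Entails C (.ge q c))
    (k : ∀ q', Entails C (.eq q (.add q' c)) → Forcing S C Δ .right q' P z Z') :
    Forcing S C Δ .right q P z Z := by
  generalize hp : Polarity.pos = p at h
  induction h generalizing q with
  | refl hc =>
    exact k q fun ρ hρ => by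
      have := entails_eq.1 hc ρ hρ
      simp only [Exp.eval] at this
      simp only [Fml.Holds, Exp.eval]
      omega
  | asserts hu hφ _ ih => exact .assertsR hu hφ (ih hq k hp)
  | @pays B B₁ B' r c c' hu hr hc hs ih =>
    have hq := entails_ge.1 hq
    have hc := fun ρ hρ => entails_eq.1 hc ρ hρ
    have hc' := entails_isNat.1 hs.isNat
    simp only [Exp.eval] at hc
    refine .paysR hu (entails_ge.2 fun ρ hρ => ?_) (ih (entails_ge.2 fun ρ hρ => ?_)
      (fun q' h => k q' fun ρ hρ => ?_) hp)
    · have := hq ρ hρ; have := hc ρ hρ; have := hc' ρ hρ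
      omega
    · have := hq ρ hρ; have := hc ρ hρ
      simp only [Exp.eval]
      omega
    · have e := entails_eq.1 h ρ hρ; have := hc ρ hρ
      simp only [Exp.eval] at e
      simp only [Fml.Holds, Exp.eval]
      omega
  | assumes => cases hp
  | gets => cases hp

/-- Force the succedent and strip it. The potential `q'` is what remains after all strips of the
sequent, `c` is reserved for the antecedents, and `a` is spent here. -/
theorem Forcing.forceR_strip (hZ : Positive S Z) (hP : P.subject = some z)
    (hs : Strip S C .pos Z a Z') (hq' : Entails C (.isNat q')) (hc : Entails C (.isNat c))
    (hq : Entails C (.eq q (.add q' (.add c a))))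
    (k : ∀ q₁, Entails C (.eq q₁ (.add q' (.add c (.const 0)))) →
      Forcing S C Δ .right q₁ P z Z') :
    Forcing S C Δ (.inv []) q P z Z := by
  refine .forceR hZ hP (.right_of_strip hs (entails_ge.2 fun ρ hρ => ?_)
    fun q₁ h₁ => k q₁ fun ρ hρ => ?_)
  · have e₁ := entails_isNat.1 hq' ρ hρ
    have e₂ := entails_isNat.1 hc ρ hρ
    have e₃ := entails_eq.1 hq ρ hρ
    simp only [Exp.eval] at e₃
    omega
  · have e₁ := entails_eq.1 h₁ ρ hρ
    have e₃ := entails_eq.1 hq ρ hρ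
    simp only [Exp.eval] at e₁ e₃
    simp only [Fml.Holds, Exp.eval]
    omega

/-- Force an antecedent and strip it, at the expense of `b`. -/
theorem Forcing.forceL_strip (hZ : Positive S Z) (hP : P.subject = some y ∨ y ∈ P.objects)
    (hs : Strip S C .neg B b B') (hq' : Entails C (.isNat q')) (hc₁ : Entails C (.isNat c₁))
    (ha : Entails C (.isNat a)) (hq : Entails C (.eq q (.add q' (.add c a))))
    (hc : Entails C (.eq c (.add b c₁)))
    (k : ∀ q₁, Entails C (.eq q₁ (.add q' (.add c₁ a))) → Forcing S C Δ (.left y B') q₁ P z Z) :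
    Forcing S C ((y, B) ::ₘ Δ) (.inv []) q P z Z := by
  refine .forceL hZ hP (.left_of_strip hs (entails_ge.2 fun ρ hρ => ?_)
    fun q₁ h₁ => k q₁ fun ρ hρ => ?_)
  · have e₁ := entails_isNat.1 hq' ρ hρ
    have e₂ := entails_isNat.1 hc₁ ρ hρ
    have e₃ := entails_isNat.1 ha ρ hρ
    have e₄ := entails_eq.1 hq ρ hρ
    have e₅ := entails_eq.1 hc ρ hρ
    simp only [Exp.eval] at e₄ e₅
    omega
  · have e₁ := entails_eq.1 h₁ ρ hρ
    have e₃ := entails_eq.1 hq ρ hρ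
    have e₄ := entails_eq.1 hc ρ hρ
    simp only [Exp.eval] at e₁ e₃ e₄
    simp only [Fml.Holds, Exp.eval]
    omega

/-- Force an antecedent that is handed over, strip it to a structural type and release it. -/
theorem Forcing.handOver (hZ : Positive S Z) (hP : y ∈ P.objects)
    (hs : Strip S C .neg B b B') (hB' : Structural S B') (hq' : Entails C (.isNat q'))
    (hc₁ : Entails C (.isNat c₁)) (ha : Entails C (.isNat a))
    (hq : Entails C (.eq q (.add q' (.add c a)))) (hc : Entails C (.eq c (.add b c₁)))
    (k : ∀ q₁, Entails C (.eq q₁ (.add q' (.add c₁ a))) →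
      Forcing S C ((y, B') ::ₘ Δ) (.inv []) q₁ P z Z) :
    Forcing S C ((y, B) ::ₘ Δ) (.inv []) q P z Z :=
  .forceL_strip hZ (.inr hP) hs hq' hc₁ ha hq hc fun q₁ h₁ => .unforce hB' hP (k q₁ h₁)

end Force

/-- Force all arguments of a spawned process one after the other, strip them to structural types
and release them. -/
theorem Forcing.handOver_args {S : Sig} {n k : ℕ} {C : Fml n} {Γ Δ Δ' : Ctx n} {P : Proc n}
    {z : Chan} {q q' a c : Exp n} {Z : Ty n} {D : List (Chan × Ty n)} {ys : List Chan}
    {e : Fin k → Exp n} {Bs : List (Ty k)} (hD : MatchArgs S C D ys e Bs)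
    (hBs : ∀ B ∈ Bs, Structural S B) (hys : ∀ y ∈ ys, y ∈ P.objects) (hZ : Positive S Z)
    (hΔ : StableCtx S C Δ) (hs : CtxStrip S C .neg Δ c ((D : Ctx n) + Δ'))
    (hq' : Entails C (.isNat q')) (ha : Entails C (.isNat a))
    (hq : Entails C (.eq q (.add q' (.add c a))))
    (k : ∀ (D' : List (Chan × Ty n)) (Δ₀ : Ctx n) (q₁ c₁ : Exp n), MatchArgs S C D' ys e Bs →
      (∀ d ∈ D', Structural S d.2) → StableCtx S C Δ₀ → CtxStrip S C .neg Δ₀ c₁ Δ' →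
      Entails C (.eq q₁ (.add q' (.add c₁ a))) →
      Forcing S C (Γ + ((D' : Ctx n) + Δ₀)) (.inv []) q₁ P z Z) :
    Forcing S C (Γ + Δ) (.inv []) q P z Z := by
  induction D generalizing ys Bs Γ Δ c q with
  | nil =>
    rw [Multiset.coe_nil, zero_add] at hs
    have := k [] Δ q c hD (by simp) hΔ hs hq
    rwa [Multiset.coe_nil, zero_add] at this
  | cons d D ih =>
    obtain ⟨rfl, hD⟩ := hD
    cases hD with
    | @cons _ B _ Bs hB hD =>
    rw [← Multiset.cons_coe, Multiset.cons_add] at hs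
    rw [List.forall_mem_cons] at hBs
    obtain ⟨A, Δ₁, b, c₁, rfl, hA, hΔ₁, hc⟩ := hs.of_cons_right
    rw [stableCtx_cons] at hΔ
    obtain ⟨A', hA', hstr, hA'B⟩ :=
      hB.exists_structural_left (hA.negative hΔ.1.2) (hBs.1.subst e)
    rw [List.map_cons, List.forall_mem_cons] at hys
    rw [Multiset.add_cons]
    refine .handOver hZ hys.1 (hA.trans_zero hA') hstr hq' hΔ₁.isNat ha hq hc fun q₁ hq₁ => ?_
    rw [← Multiset.cons_add]
    refine ih ⟨rfl, hD⟩ hBs.2 hys.2 hΔ.2 hΔ₁ hq₁ fun D' Δ₀ q₂ c₂ h₁ h₂ h₃ h₄ h₅ => ?_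
    have := k ((d.1, A') :: D') Δ₀ q₂ c₂ ⟨by simp [h₁.1], .cons hA'B h₁.2⟩
      (List.forall_mem_cons.2 ⟨hstr, h₂⟩) h₃ h₄ h₅
    rwa [← Multiset.cons_coe, Multiset.cons_add, Multiset.add_cons, ← Multiset.cons_add] at this

/-! ### Completeness -/

/-- Completeness of the forcing calculus for the program `P`, from any inversion stage. -/
def CompleteFor (S : Sig) {n : ℕ} (P : Proc n) : Prop :=
  ∀ ⦃C : Fml n⦄ ⦃Δ : Ctx n⦄ ⦃Ω : List (Chan × Ty n)⦄ ⦃q : Exp n⦄ ⦃x : Chan⦄ ⦃A : Ty n⦄,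
    StableCtx S C Δ → (∀ d ∈ Ω, d.2.Proper S C) → A.Proper S C → Entails C (.isNat q) →
    ImplicitTyped S C ((Ω : Ctx n) + Δ) q P x A → Forcing S C Δ (.inv Ω) q P x A

/-- Completeness for the programs that remain after the first action. -/
def SubComplete (S : Sig) : {n : ℕ} → Proc n → Prop
  | _, .spawn _ _ _ _ _ Q => CompleteFor S Q
  | _, .sendl _ _ P => CompleteFor S P
  | _, .case _ _ P => ∀ l, CompleteFor S (P l)
  | _, .send _ _ P => CompleteFor S P
  | _, .recv _ _ P => CompleteFor S P
  | _, .wait _ P => CompleteFor S P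
  | _, .sendn _ _ P => CompleteFor S P
  | _, .recvn _ P => CompleteFor S P
  | _, .work _ P => CompleteFor S P
  | _, _ => True

/-- Completeness applied after an action: what was stripped prematurely is put back first. -/
theorem CompleteFor.of_strip {S : Sig} {n : ℕ} {P : Proc n} (hP : CompleteFor S P) {C : Fml n}
    {Δ Δ' Γ : Ctx n} {Ω : List (Chan × Ty n)} {q q' c a : Exp n} {z : Chan} {Z Z' : Ty n}
    (hΔ : StableCtx S C Δ) (hΩ : ∀ d ∈ Ω, d.2.Proper S C) (hZ : Z.Proper S C)
    (hsΔ : CtxStrip S C .neg Δ c Δ') (hsZ : Strip S C .pos Z a Z')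
    (hq' : Entails C (.isNat q')) (hq : Entails C (.eq q (.add q' (.add c a))))
    (h : ImplicitTyped S C Γ q' P z Z') (hΓ : Γ = (Ω : Ctx n) + Δ') :
    Forcing S C Δ (.inv Ω) q P z Z := by
  subst hΓ
  refine hP hΔ hΩ hZ (entails_isNat.2 fun ρ hρ => ?_) (Typed.unstrip hsΔ hsZ h hq' hq)
  have e₁ := entails_isNat.1 hq' ρ hρ
  have e₂ := entails_isNat.1 hsΔ.isNat ρ hρ
  have e₃ := entails_isNat.1 hsZ.isNat ρ hρ
  have e₄ := entails_eq.1 hq ρ hρ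
  simp only [Exp.eval] at e₄
  omega

theorem coe_cons_add {n : ℕ} (d : Chan × Ty n) (Ω : List (Chan × Ty n)) (Δ : Ctx n) :
    ((d :: Ω : List (Chan × Ty n)) : Ctx n) + Δ = d ::ₘ ((Ω : Ctx n) + Δ) := by
  rw [← Multiset.cons_coe, Multiset.cons_add]

theorem coe_singleton_add {n : ℕ} (d : Chan × Ty n) (Δ : Ctx n) :
    (([d] : List (Chan × Ty n)) : Ctx n) + Δ = d ::ₘ Δ := Multiset.singleton_add d Δ

theorem coe_nil_add {n : ℕ} (Δ : Ctx n) :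
    (([] : List (Chan × Ty n)) : Ctx n) + Δ = Δ := zero_add Δ

/-- The focusing step. In a stable sequent, the final segment of an implicit derivation strips
some channels before the first action of the program. Forcing strips only the channels that take
part in that action; the strips of the others are postponed beyond it. -/
theorem Forcing.of_stable {S : Sig} (hS : S.WellFormed) {n : ℕ} {C : Fml n} {Δ Δ' : Ctx n}
    {q q' c a : Exp n} {P : Proc n} {z : Chan} {Z Z' : Ty n}
    (h : ImplicitTyped S C Δ' q' P z Z') (hP : SubComplete S P) (hΔ : StableCtx S C Δ)
    (hZ : Z.Proper S C) (hZp : Positive S Z) (hsΔ : CtxStrip S C .neg Δ c Δ')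
    (hsZ : Strip S C .pos Z a Z') (hq' : Entails C (.isNat q'))
    (hq : Entails C (.eq q (.add q' (.add c a)))) : Forcing S C Δ (.inv []) q P z Z := by
  have nilP : ∀ {n : ℕ} {C : Fml n}, ∀ d ∈ ([] : List (Chan × Ty n)), d.2.Proper S C := by simp
  have oneP : ∀ {n : ℕ} {C : Fml n} {x : Chan} {A : Ty n}, A.Proper S C →
      ∀ d ∈ [(x, A)], d.2.Proper S C := by simp
  induction h with
  | @id n C q' x y A B h₁ h₂ =>
    obtain ⟨A₀, Δ₁, b, c₁, rfl, hsA, hΔ₁, hc⟩ := CtxStrip.of_cons_right (Δ' := 0) hsΔ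
    obtain ⟨rfl, -⟩ := hΔ₁.eq_zero_right
    rw [stableCtx_cons] at hΔ
    have hA := hsA.negative hΔ.1.2
    -- `A` and `B` are structural already unless `C` is contradictory
    obtain ⟨B', hB', hstrB, hAB'⟩ := h₂.exists_structural_right hA (hsZ.positive hZp)
    obtain ⟨A', hA', hstrA, hA'B'⟩ := hAB'.exists_structural_left hA hstrB
    refine .handOver hZp (List.mem_singleton_self _) (hsA.trans_zero hA') hstrA hq' hΔ₁.isNat
      hsZ.isNat hq hc fun q₁ hq₁ => ?_
    refine .forceR_strip hZp rfl (hsZ.trans_zero hB') hq' hΔ₁.isNat hq₁ fun q₂ hq₂ => ?_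
    refine .id hstrA hstrB (fun ρ hρ => ?_) hA'B'
    have e₁ := entails_eq.1 hq₂ ρ hρ
    have e₂ := entails_eq.1 h₁ ρ hρ
    have e₃ := entails_eq.1 hΔ₁.eq_zero_right.2 ρ hρ
    simp only [Exp.eval] at e₁ e₂ e₃
    simp only [Fml.Holds, Exp.eval]
    omega
  | spawn h₁ h₂ h₃ h₄ h₅ h₆ h₇ _ =>
    rw [← coe_nil_add Δ]
    refine .handOver_args h₄ (hS.structural_args h₁) (fun _ h => h) hZp hΔ hsΔ hq' hsZ.isNat hq
      fun D Δ₀ q₁ c₁ hD hstr hΔ₀ hsΔ₀ hq₁ => ?_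
    rw [coe_nil_add]
    have hF := hS.decl h₁ _ (List.mem_cons_self ..)
    refine .spawn hZp h₁ h₂ (h₃.ge_of_eq_add hsΔ₀.isNat hsZ.isNat hq₁) hstr hD
      ((hsΔ₀.fresh_iff _).2 h₅) h₆ ?_
    exact CompleteFor.of_strip hP hΔ₀ (oneP ⟨hF.1.subst (.tt h₂), hF.2.1.subst _⟩) hZ hsΔ₀ hsZ
      h₃.isNat_sub (hq₁.sub_eq_add _) h₇ (coe_singleton_add _ _).symm
  | ichoiceR l h₁ h₂ _ =>
    exact .forceR_strip hZp rfl hsZ hq' hsΔ.isNat hq fun q₁ hq₁ => .ichoiceR l h₁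
      (CompleteFor.of_strip hP hΔ nilP (((hZ.strip hS hsZ).of_unfold hS h₁).ichoice l) hsΔ
        (.zero _) hq' hq₁ h₂ (coe_nil_add _).symm)
  | echoiceR h₁ h₂ _ =>
    exact .forceR_strip hZp rfl hsZ hq' hsΔ.isNat hq fun q₁ hq₁ => .echoiceR h₁ fun l =>
      (CompleteFor.of_strip (hP l) hΔ nilP (((hZ.strip hS hsZ).of_unfold hS h₁).echoice l) hsΔ
        (.zero _) hq' hq₁ (h₂ l) (coe_nil_add _).symm)
  | ichoiceL h₁ h₂ _ =>
    obtain ⟨A, Δ₁, b, c₁, rfl, hsA, hsΔ₁, hc⟩ := hsΔ.of_cons_right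
    rw [stableCtx_cons] at hΔ
    exact .forceL_strip hZp (.inl rfl) hsA hq' hsΔ₁.isNat hsZ.isNat hq hc fun q₁ hq₁ =>
      .ichoiceL hZp h₁ fun l => CompleteFor.of_strip (hP l) hΔ.2
        (oneP (((hΔ.1.1.strip hS hsA).of_unfold hS h₁).ichoice l)) hZ hsΔ₁ hsZ hq' hq₁ (h₂ l)
        (coe_singleton_add _ _).symm
  | echoiceL l h₁ h₂ _ =>
    obtain ⟨A, Δ₁, b, c₁, rfl, hsA, hsΔ₁, hc⟩ := hsΔ.of_cons_right
    rw [stableCtx_cons] at hΔ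
    exact .forceL_strip hZp (.inl rfl) hsA hq' hsΔ₁.isNat hsZ.isNat hq hc fun q₁ hq₁ =>
      .echoiceL l hZp h₁ (CompleteFor.of_strip hP hΔ.2
        (oneP (((hΔ.1.1.strip hS hsA).of_unfold hS h₁).echoice l)) hZ hsΔ₁ hsZ hq' hq₁ h₂
        (coe_singleton_add _ _).symm)
  | tensorR h₁ h₂ h₃ _ =>
    obtain ⟨A, Δ₁, b, c₁, rfl, hsA, hsΔ₁, hc⟩ := hsΔ.of_cons_right
    rw [stableCtx_cons] at hΔ
    have hT := ((hZ.strip hS hsZ).of_unfold hS h₁).tensor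
    obtain ⟨A', hA', hstr, hA'A₂⟩ := h₂.exists_structural_left (hsA.negative hΔ.1.2) hT.1
    exact .handOver hZp (List.mem_singleton_self _) (hsA.trans_zero hA') hstr hq' hsΔ₁.isNat
      hsZ.isNat hq hc fun q₁ hq₁ => .forceR_strip hZp rfl hsZ hq' hsΔ₁.isNat hq₁ fun q₂ hq₂ =>
        .tensorR h₁ hstr hA'A₂ (CompleteFor.of_strip hP hΔ.2 nilP hT.2.2 hsΔ₁ (.zero _) hq' hq₂ h₃
          (coe_nil_add _).symm)
  | tensorL h₁ h₂ h₃ h₄ h₅ _ =>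
    obtain ⟨A, Δ₁, b, c₁, rfl, hsA, hsΔ₁, hc⟩ := hsΔ.of_cons_right
    rw [stableCtx_cons] at hΔ
    have hT := ((hΔ.1.1.strip hS hsA).of_unfold hS h₁).tensor
    exact .forceL_strip hZp (.inl rfl) hsA hq' hsΔ₁.isNat hsZ.isNat hq hc fun q₁ hq₁ =>
      .tensorL hZp h₁ ((hsΔ₁.fresh_iff _).2 h₂) h₃ h₄ (CompleteFor.of_strip hP hΔ.2
        (List.forall_mem_cons.2 ⟨hT.2.1, oneP hT.2.2⟩) hZ hsΔ₁ hsZ hq' hq₁ h₅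
        (by rw [coe_cons_add, coe_singleton_add]))
  | lolliR h₁ h₂ h₃ h₄ _ =>
    have hT := ((hZ.strip hS hsZ).of_unfold hS h₁).lolli
    exact .forceR_strip hZp rfl hsZ hq' hsΔ.isNat hq fun q₁ hq₁ =>
      .lolliR h₁ ((hsΔ.fresh_iff _).2 h₂) h₃ (CompleteFor.of_strip hP hΔ (oneP hT.2.1) hT.2.2 hsΔ
        (.zero _) hq' hq₁ h₄ (coe_singleton_add _ _).symm)
  | @lolliL n C Δ' q' Q x w z A A₁ A₂ B Z' h₁ h₂ h₃ _ =>
    obtain ⟨A₀, Δ₁, b, c₁, rfl, hsA₁, hsΔ₁, hc⟩ := hsΔ.of_cons_right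
    obtain ⟨D, Δ₂, b₂, c₂, rfl, hsD, hsΔ₂, hc₂⟩ := hsΔ₁.of_cons_right
    rw [stableCtx_cons, stableCtx_cons] at hΔ
    have hT := ((hΔ.2.1.1.strip hS hsD).of_unfold hS h₁).lolli
    obtain ⟨A', hA', hstr, hA'A₂⟩ := h₂.exists_structural_left (hsA₁.negative hΔ.1.2) hT.1
    refine .handOver hZp (List.mem_singleton_self _) (hsA₁.trans_zero hA') hstr hq' hsΔ₁.isNat
      hsZ.isNat hq hc fun q₁ hq₁ => ?_
    rw [Multiset.cons_swap]
    exact .forceL_strip hZp (.inl rfl) hsD hq' hsΔ₂.isNat hsZ.isNat hq₁ hc₂ fun q₂ hq₂ =>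
      .lolliL hZp h₁ hstr hA'A₂ (CompleteFor.of_strip hP hΔ.2.2 (oneP hT.2.2) hZ hsΔ₂ hsZ hq' hq₂
        h₃ (coe_singleton_add _ _).symm)
  | oneR h₁ h₂ =>
    obtain ⟨rfl, hc⟩ := hsΔ.eq_zero_right
    refine .forceR_strip hZp rfl hsZ hq' hsΔ.isNat hq fun q₁ hq₁ => .oneR h₁ fun ρ hρ => ?_
    have e₁ := entails_eq.1 hq₁ ρ hρ
    have e₂ := entails_eq.1 h₂ ρ hρ
    have e₃ := entails_eq.1 hc ρ hρ
    simp only [Exp.eval] at e₁ e₂ e₃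
    simp only [Fml.Holds, Exp.eval]
    omega
  | oneL h₁ h₂ _ =>
    obtain ⟨A, Δ₁, b, c₁, rfl, hsA, hsΔ₁, hc⟩ := hsΔ.of_cons_right
    rw [stableCtx_cons] at hΔ
    exact .forceL_strip hZp (.inl rfl) hsA hq' hsΔ₁.isNat hsZ.isNat hq hc fun q₁ hq₁ =>
      .oneL hZp h₁ (CompleteFor.of_strip hP hΔ.2 nilP hZ hsΔ₁ hsZ hq' hq₁ h₂
        (coe_nil_add _).symm)
  | exR h₁ h₂ h₃ _ =>
    exact .forceR_strip hZp rfl hsZ hq' hsΔ.isNat hq fun q₁ hq₁ => .exR h₁ h₂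
      (CompleteFor.of_strip hP hΔ nilP (((hZ.strip hS hsZ).of_unfold hS h₁).ex.inst h₂) hsΔ
        (.zero _) hq' hq₁ h₃ (coe_nil_add _).symm)
  | exL h₁ h₂ _ =>
    obtain ⟨A, Δ₁, b, c₁, rfl, hsA, hsΔ₁, hc⟩ := hsΔ.of_cons_right
    rw [stableCtx_cons] at hΔ
    exact .forceL_strip hZp (.inl rfl) hsA hq' hsΔ₁.isNat hsZ.isNat hq hc fun q₁ hq₁ =>
      .exL hZp h₁ (CompleteFor.of_strip hP hΔ.2.weaken
        (oneP ((hΔ.1.1.strip hS hsA).of_unfold hS h₁).ex) hZ.weaken hsΔ₁.weaken hsZ.weaken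
        hq'.weaken hq₁.weaken h₂ (coe_singleton_add _ _).symm)
  | allR h₁ h₂ _ =>
    exact .forceR_strip hZp rfl hsZ hq' hsΔ.isNat hq fun q₁ hq₁ => .allR h₁
      (CompleteFor.of_strip hP hΔ.weaken nilP ((hZ.strip hS hsZ).of_unfold hS h₁).all hsΔ.weaken
        (.zero _) hq'.weaken hq₁.weaken h₂ (coe_nil_add _).symm)
  | allL h₁ h₂ h₃ _ =>
    obtain ⟨A, Δ₁, b, c₁, rfl, hsA, hsΔ₁, hc⟩ := hsΔ.of_cons_right
    rw [stableCtx_cons] at hΔ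
    exact .forceL_strip hZp (.inl rfl) hsA hq' hsΔ₁.isNat hsZ.isNat hq hc fun q₁ hq₁ =>
      .allL hZp h₁ h₂ (CompleteFor.of_strip hP hΔ.2
        (oneP (((hΔ.1.1.strip hS hsA).of_unfold hS h₁).all.inst h₂)) hZ hsΔ₁ hsZ hq' hq₁ h₃
        (coe_singleton_add _ _).symm)
  | work h₁ h₂ _ =>
    exact .work hZp (h₁.ge_of_eq_add hsΔ.isNat hsZ.isNat hq) (CompleteFor.of_strip hP hΔ nilP hZ
      hsΔ hsZ h₁.isNat_sub (hq.sub_eq_add _) h₂ (coe_nil_add _).symm)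
  | unsat h₁ => exact .unsat hZp h₁
  -- the lazy rules leave the program unchanged and prolong the strips
  | assertsR _ h₁ h₂ _ ih =>
    exact ih hP hΔ hZ hZp hsΔ (hsZ.trans_zero (.asserts h₁ h₂ (.zero _))) hq' hq
  | @paysR n C Δ' q' r P x Z' Z₁ _ h₁ h₂ _ ih =>
    have hr := ((hZ.strip hS hsZ).of_unfold hS h₁).pays.1
    refine ih hP hΔ hZ hZp hsΔ (hsZ.trans (.pays h₁ hr (.eq_refl C _) (.zero _))
      (.eq_refl C _)) h₂.isNat_sub (hq.eq_trans fun ρ hρ => ?_)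
    simp only [Fml.Holds, Exp.eval]
    omega
  | assumesL _ h₁ h₂ _ ih =>
    obtain ⟨A, Δ₁, b, c₁, rfl, hsA, hsΔ₁, hc⟩ := hsΔ.of_cons_right
    exact ih hP hΔ hZ hZp (.cons (hsA.trans_zero (.assumes h₁ h₂ (.zero _))) hsΔ₁ hc) hsZ hq' hq
  | getsL _ h₁ h₂ _ ih =>
    obtain ⟨A, Δ₁, b, c₁, rfl, hsA, hsΔ₁, hc⟩ := hsΔ.of_cons_right
    have hr := (((stableCtx_cons.1 hΔ).1.1.strip hS hsA).of_unfold hS h₁).gets.1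
    refine ih hP hΔ hZ hZp (.cons (hsA.trans (.gets h₁ hr (.eq_refl _ _) (.zero _))
      (.eq_refl _ _)) hsΔ₁ (.eq_refl _ _)) hsZ h₂.isNat_sub (hq.eq_trans fun ρ hρ => ?_)
    have e := entails_eq.1 hc ρ hρ
    simp only [Exp.eval] at e
    simp only [Fml.Holds, Exp.eval]
    omega
  -- the invertible rules do not apply to stable sequents
  | assertsL _ h₁ _ _ =>
    obtain ⟨A, Δ₁, b, c₁, rfl, hsA, hsΔ₁, hc⟩ := hsΔ.of_cons_right
    exact ((hsA.negative (stableCtx_cons.1 hΔ).1.2).of_unfold.1 _ _ h₁).elim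
  | paysL _ h₁ _ _ =>
    obtain ⟨A, Δ₁, b, c₁, rfl, hsA, hsΔ₁, hc⟩ := hsΔ.of_cons_right
    exact ((hsA.negative (stableCtx_cons.1 hΔ).1.2).of_unfold.2 _ _ h₁).elim
  | assumesR _ h₁ _ _ => exact ((hsZ.positive hZp).of_unfold.1 _ _ h₁).elim
  | getsR _ h₁ _ _ => exact ((hsZ.positive hZp).of_unfold.2 _ _ h₁).elim
  | _ hm => cases hm

/-- Completeness for stable sequents of `P`. -/
def StableComplete (S : Sig) {n : ℕ} (P : Proc n) : Prop :=
  ∀ ⦃C : Fml n⦄ ⦃Δ : Ctx n⦄ ⦃q : Exp n⦄ ⦃x : Chan⦄ ⦃A : Ty n⦄, StableCtx S C Δ → A.Proper S C →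
    Positive S A → Entails C (.isNat q) → ImplicitTyped S C Δ q P x A →
    Forcing S C Δ (.inv []) q P x A

/-- The left inversion phase: positive antecedents are stripped, and negative ones are moved. -/
theorem StableComplete.inversion_left {S : Sig} (hS : S.WellFormed) {n : ℕ} {P : Proc n}
    (hP : StableComplete S P) {C : Fml n} {Δ : Ctx n} {Ω : List (Chan × Ty n)} {q : Exp n}
    {z : Chan} {Z : Ty n} (hΔ : StableCtx S C Δ) (hΩ : ∀ d ∈ Ω, d.2.Proper S C)
    (hZ : Z.Proper S C) (hZp : Positive S Z) (hq : Entails C (.isNat q))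
    (h : ImplicitTyped S C ((Ω : Ctx n) + Δ) q P z Z) : Forcing S C Δ (.inv Ω) q P z Z := by
  induction Ω generalizing C Δ q with
  | nil => rw [coe_nil_add] at h; exact hP hΔ hZ hZp hq h
  | cons d Ω ih =>
    obtain ⟨x, A⟩ := d
    rw [List.forall_mem_cons] at hΩ
    obtain ⟨hA, hΩ⟩ := hΩ
    rw [coe_cons_add] at h
    have neg : ∀ {C : Fml n} {q : Exp n} {A : Ty n}, Negative S A → A.Proper S C →
        StableCtx S C Δ → (∀ d ∈ Ω, d.2.Proper S C) → Z.Proper S C → Entails C (.isNat q) →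
        ImplicitTyped S C ((x, A) ::ₘ ((Ω : Ctx n) + Δ)) q P z Z →
        Forcing S C Δ (.inv ((x, A) :: Ω)) q P z Z := fun hn hA hΔ hΩ hZ hq h =>
      .move hZp hn (ih (stableCtx_cons.2 ⟨⟨hA, hn⟩, hΔ⟩) hΩ hZ hq (by rwa [Multiset.add_cons]))
    rcases hA.2.positive_or_negative with hp | hn
    · change A.Proper S C at hA
      change Positive S A at hp
      induction hp generalizing C q with
      | structural hstr => exact neg (.structural hstr) hA hΔ hΩ hZ hq h
      | @asserts A A' φ hu _ ih' =>
        have hC := Entails.and_left C φ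
        have hpol : ∀ d ∈ (x, A) ::ₘ ((Ω : Ctx n) + Δ), d.2.Polarized S :=
          Multiset.forall_mem_cons.2 ⟨hA.2, fun d hd => (Multiset.mem_add.1 hd).elim
            (fun hd => (hΩ d (Multiset.mem_coe.1 hd)).2) fun hd => (hΔ d hd).1.2⟩
        refine .assertsL hZp hu (ih' (hΔ.mono hC) (hZ.mono hC) (hC.trans hq)
          (Typed.strip hS (h.mono hC (.eq_refl _ q)) hpol hZ.2
            (.cons (.asserts hu (.and_right C φ) (.zero _)) (.refl _) (.eq_refl _ _)) (.zero _)
            fun _ _ => ?_)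
          (fun d hd => (hΩ d hd).mono hC) (hA.of_unfold hS hu).asserts)
        simp [Fml.Holds, Exp.eval]
      | @pays A A' r hu _ ih' =>
        have hpol : ∀ d ∈ (x, A) ::ₘ ((Ω : Ctx n) + Δ), d.2.Polarized S :=
          Multiset.forall_mem_cons.2 ⟨hA.2, fun d hd => (Multiset.mem_add.1 hd).elim
            (fun hd => (hΩ d (Multiset.mem_coe.1 hd)).2) fun hd => (hΔ d hd).1.2⟩
        have hA' := (hA.of_unfold hS hu).pays
        refine .paysL hZp hu (ih' hΔ hZ (hq.isNat_add hA'.1)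
          (Typed.strip hS h hpol hZ.2
            (.cons (.pays hu hA'.1 (.eq_refl _ _) (.zero _)) (.refl _) (.eq_refl _ _)) (.zero _)
            fun _ _ => ?_) hΩ hA'.2)
        simp [Fml.Holds, Exp.eval]
    · exact neg hn hA hΔ hΩ hZ hq h

/-- The right inversion phase, followed by the left one. -/
theorem StableComplete.completeFor {S : Sig} (hS : S.WellFormed) {n : ℕ} {P : Proc n}
    (hP : StableComplete S P) : CompleteFor S P := by
  intro C Δ Ω q x A hΔ hΩ hA hq h
  rcases hA.2.positive_or_negative with hp | hn
  · exact hP.inversion_left hS hΔ hΩ hA hp hq h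
  have hpol : ∀ d ∈ (Ω : Ctx n) + Δ, d.2.Polarized S := fun d hd => (Multiset.mem_add.1 hd).elim
    (fun hd => (hΩ d (Multiset.mem_coe.1 hd)).2) fun hd => (hΔ d hd).1.2
  induction hn generalizing C q with
  | structural hstr => exact hP.inversion_left hS hΔ hΩ hA (.structural hstr) hq h
  | @assumes A A' φ hu _ ih =>
    have hC := Entails.and_left C φ
    exact .assumesR hu (ih (hΔ.mono hC) (fun d hd => (hΩ d hd).mono hC)
      (hA.of_unfold hS hu).assumes (hC.trans hq) (Typed.strip hS (h.mono hC (.eq_refl _ q)) hpol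
        hA.2 (.refl _) (.assumes hu (.and_right C φ) (.zero _)) fun _ _ => (add_zero _).symm))
  | @gets A A' r hu _ ih =>
    have hA' := (hA.of_unfold hS hu).gets
    refine .getsR hu (ih hΔ hΩ hA'.2 (hq.isNat_add hA'.1) (Typed.strip hS h hpol hA.2 (.refl _)
      (.gets hu hA'.1 (.eq_refl _ _) (.zero _)) fun _ _ => ?_))
    simp only [Fml.Holds, Exp.eval]
    omega

theorem completeFor_of_subComplete {S : Sig} (hS : S.WellFormed) {n : ℕ} {P : Proc n}
    (hP : SubComplete S P) : CompleteFor S P :=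
  StableComplete.completeFor hS fun _ _ _ _ _ hΔ hA hp hq h =>
    .of_stable hS h hP hΔ hA hp (.refl _) (.zero _) hq fun _ _ => (add_zero _).symm

/-- Completeness, by induction on the program. -/
theorem completeFor {S : Sig} (hS : S.WellFormed) {n : ℕ} (P : Proc n) : CompleteFor S P := by
  induction P with
  | spawn _ _ _ _ _ _ ih => exact completeFor_of_subComplete hS ih
  | sendl _ _ _ ih => exact completeFor_of_subComplete hS ih
  | case _ _ _ ih => exact completeFor_of_subComplete hS ih
  | send _ _ _ ih => exact completeFor_of_subComplete hS ih
  | recv _ _ _ ih => exact completeFor_of_subComplete hS ih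
  | wait _ _ ih => exact completeFor_of_subComplete hS ih
  | sendn _ _ _ ih => exact completeFor_of_subComplete hS ih
  | recvn _ _ ih => exact completeFor_of_subComplete hS ih
  | work _ _ ih => exact completeFor_of_subComplete hS ih
  | _ => exact completeFor_of_subComplete hS trivial

end ErgoSession

theorem theorem4 (S : Sig) (hS : S.WellFormed) {n : ℕ} (C : Fml n) (Δ : List (Chan × Ty n))
    (q : Exp n) (P : Proc n) (x : Chan) (A : Ty n)
    (hdistinct : Distinct (Δ : Ctx n) x)
    (hq : Entails C (.isNat q))
    (hA : A.Valid S C ∧ A.Polarized S)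
    (hΔ : ∀ d ∈ Δ, d.2.Valid S C ∧ d.2.Polarized S) :
    (ImplicitTyped S C (Δ : Ctx n) q P x A → Forcing S C 0 (.inv Δ) q P x A) ∧
    (Forcing S C 0 (.inv Δ) q P x A → ImplicitTyped S C (Δ : Ctx n) q P x A) ∧
    (Forcing S C 0 (.inv Δ) q P x A ↔
      ∃ E : Proc n, E.erase = P ∧ ExplicitTyped S C (Δ : Ctx n) q E x A) := by
  have complete : ImplicitTyped S C (Δ : Ctx n) q P x A → Forcing S C 0 (.inv Δ) q P x A :=
    fun h => completeFor hS P (by simp [StableCtx]) hΔ hA hq (by rwa [add_zero])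
  have sound : Forcing S C 0 (.inv Δ) q P x A → ImplicitTyped S C (Δ : Ctx n) q P x A :=
    fun h => by simpa [Stage.ctx] using h.sound
  refine ⟨complete, sound, fun h => (sound h).exists_explicit, ?_⟩
  rintro ⟨E, rfl, hE⟩
  exact complete hE.erase
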